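/- Let $\mathcal A,\mathcal B$ be disjoint countable totally ordered sets, each with a parity (even/odd) on its elements, and let $n\ge 1$. Let $\mathcal F$ be the set of pairs $T=(T^+,T^-)$, where $T^+$ (resp. $T^-$) is a one-row semistandard tableau with entries in $\mathcal A$ (resp. $\mathcal B$): entries increase weakly from left to right and odd entries are not repeated. Write $T\in\mathcal F(k)$ if $k=|T^+|-|T^-|$, where $|\cdot|$ is the number of boxes. Elements of $\mathcal F^n$ are written $\mathbf T=(T_1,\dots,T_n)$, and $m_{cj}$ denotes the multiplicity of $c\in\mathcal A\sqcup\mathcal B$ in $T_j$. *Local energy and combinatorial $R$-matrix.* For $T_1\in\mathcal F(k_1)$, $T_2\in\mathcal F(k_2)$ and $c\in\mathcal A\sqcup\mathcal B$ put $$\mathsf s_c=\begin{cases}(-)^{m_{c2}}(+)^{m_{c1}} & c\in\mathcal A \text{ even},\\ (+)^{m_{c1}}(-)^{m_{c2}} & c\in\mathcal A\text{ odd},\\ (-)^{m_{c1}}(+)^{m_{c2}} & c\in\mathcal B\text{ even},\\ (+)^{m_{c2}}(-)^{m_{c1}} & c\in\mathcal B\text{ odd}.\end{cases}$$ Let $\mathsf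 s=(\mathsf s_{a_k}\cdots\mathsf s_{a_1}\mathsf s_{b_1}\cdots\mathsf s_{b_l})$, where $a_k>\dots>a_1$ and $b_1<\dots<b_l$ are the entries from $\mathcal A$ and $\mathcal B$ that occur in $T_1$ or $T_2$, and cancel adjacent pairs $(+\,-)$ as long as possible, which leaves $\mathsf s^{\rm red}=(-)^{\varepsilon}(+)^{\varphi}$. Put $\mathsf H(T_1,T_2)=-\min\{\varepsilon,\varphi\}$. Define $\varsigma(T_1,T_2)$ as follows. If $k_1=k_2$, it is $(T_1,T_2)$. If $k_1>k_2$, take the entries that correspond to the leftmost $k_1-k_2$ signs $+$ of $\mathsf s^{\rm red}$, and move those in $\mathcal A$ from $T_1^+$ to $T_2^+$ and those in $\mathcal B$ from $T_2^-$ to $T_1^-$. If $k_1<k_2$, take the entries that correspond to the rightmost $k_2-k_1$ signs $-$ of $\mathsf s^{\rm red}$, and move those in $\mathcal A$ from $T_2^+$ to $T_1^+$ and those in $\mathcal B$ from $T_1^-$ to $T_2^-$. For $1\le i\le n-1$ let $\mathsf H_i(\mathbf T)=\mathsf H(T_i,T_{i+1})$, let $\varsigma_i$ act on $\mathcal F^n$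 by $\varsigma$ in the positions $i,i+1$, and let $$\mathsf D(\mathbf T)=\sum_{1\le s<t\le n}\mathsf H_s(\varsigma_{s+1}\varsigma_{s+2}\cdots\varsigma_{t-1}(\mathbf T)).$$ *Crystal structure.* Let $[n]=\{1<\dots<n\}$ be the $A_{n-1}$-crystal of the natural representation of $\mathfrak{gl}_n$ and $[-n]=\{-n<\dots<-1\}$ its dual. For $\mathbf T\in\mathcal F^n$ and $c\in\mathcal A\sqcup\mathcal B$ let $T^{(c)}$ be the tableau with $m_{cj}$ entries $j$ ($j\in[n]$) if $c\in\mathcal A$, and with $m_{cj}$ entries $-j$ if $c\in\mathcal B$, whose shape is one row if $c$ is even and one column if $c$ is odd, with entries in increasing order. Identify $T^{(c)}$ with the tensor product of its letters, the columns being read from right to left and each column from top to bottom, and identify $\mathbf T$ with $$\overset{\longleftarrow}{\bigotimes_{a\in\mathcal A}}T^{(a)}\otimes\overset{\longrightarrow}{\bigotimes_{b\in\mathcal B}}T^{(b)},$$ where $a$ runs in decreasing and $b$ in increasing order. (Tensor product rule: $\tilde e_i(x\otimes y)=\tilde e_ix\otimes y$ if $\varphi_i(x)\ge\varepsilon_i(y)$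 and $x\otimes\tilde e_iy$ otherwise; $\tilde f_i(x\otimes y)=\tilde f_ix\otimes y$ if $\varphi_i(x)>\varepsilon_i(y)$ and $x\otimes\tilde f_iy$ otherwise.) Let $S_i(b)=\tilde f_i^{\,m}b$ if $m=\langle {\rm wt}(b),h_i\rangle\ge0$ and $S_i(b)=\tilde e_i^{\,-m}b$ if $m\le 0$ be the Weyl group operators, and for $\alpha=\epsilon_s-\epsilon_t\in\Delta^+_{n-1}$ ($1\le s<t\le n$) put $\varepsilon_\alpha(b)=\varepsilon_s(S_{s+1}\cdots S_{t-1}(b))$ and $\varphi_\alpha(b)=\varphi_s(S_{s+1}\cdots S_{t-1}(b))$. **Proposition.** This identification is well defined and makes $\mathcal F^n$ a regular $A_{n-1}$-crystal: with the tensor factors labelled by $\mathcal A\sqcup\mathcal B$, it is injective and its image is stable under all $\tilde e_i,\tilde f_i$. For all $\mathbf T\in\mathcal F^n$ and $1\le i\le n-1$, $$\mathsf H_i(\mathbf T)=-\min\{\varepsilon_i(\mathbf T),\varphi_i(\mathbf T)\},\qquad \varsigma_i(\mathbf T)=S_i(\mathbf T),$$ and $$\mathsf D(\mathbf T)=-\sum_{\alpha\in\Delta^+_{n-1}}\min\{\varepsilon_\alpha(\mathbf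 T),\varphi_\alpha(\mathbf T)\}.$$ -/

import Mathlib

namespace FockCrystal

/-! ### Crystals of type `A_{n-1}` -/

/-- The smaller index `i` of the simple root `α_i = ε_i - ε_{i+1}`; simple roots of `A_{n-1}` are
indexed by `Fin (n - 1)`, coordinates of the weight lattice `ℤⁿ` by `Fin n` (both from `0`). -/
def lo {n : ℕ} (i : Fin (n - 1)) : Fin n := ⟨i.1, by omega⟩

/-- The larger index `i + 1` of the simple root `α_i = ε_i - ε_{i+1}`. -/
def hi {n : ℕ} (i : Fin (n - 1)) : Fin n := ⟨i.1 + 1, by omega⟩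

/-- The pairing `⟨w, h_i⟩` of a weight with the `i`-th simple coroot. -/
def coroot {n : ℕ} (i : Fin (n - 1)) (w : Fin n → ℤ) : ℤ := w (lo i) - w (hi i)

/-- The simple root `α_i = ε_i - ε_{i+1}`. -/
def simpleRoot {n : ℕ} (i : Fin (n - 1)) : Fin n → ℤ :=
  Pi.single (lo i) 1 - Pi.single (hi i) 1

/-- The positive roots `ε_s - ε_t`, `s < t`, of `A_{n-1}`. -/
abbrev PosRoot (n : ℕ) : Type := {st : Fin n × Fin n // st.1 < st.2}

/-- For `α = ε_s - ε_t`, the index of the simple root `α_s`. -/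
def PosRoot.first {n : ℕ} (α : PosRoot n) : Fin (n - 1) :=
  ⟨α.1.1.1, by
    have h1 : α.1.1.1 < α.1.2.1 := α.2
    have h2 := α.1.2.2
    omega⟩

/-- For operators `S_i` on `X` and `α = ε_s - ε_t`: the element `S_{s+1} S_{s+2} ⋯ S_{t-1} (x)`
(`S_{t-1}` is applied first). -/
def PosRoot.act {n : ℕ} {X : Type*} (S : Fin (n - 1) → X → X) (α : PosRoot n) (x : X) : X :=
  ((List.finRange (n - 1)).filter fun i => α.1.1.1 < i.1 ∧ i.1 < α.1.2.1).foldr S x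

/-- The data of an `A_{n-1}`-crystal on a set `X`; `none` is the element `0` that is added to `X`.
The laws are collected in `IsCrystal` and `IsRegular` below. -/
structure CrystalData (n : ℕ) (X : Type*) where
  wt : X → Fin n → ℤ
  ε : Fin (n - 1) → X → ℤ
  φ : Fin (n - 1) → X → ℤ
  e : Fin (n - 1) → X → Option X
  f : Fin (n - 1) → X → Option X

namespace CrystalData

variable {n : ℕ} {X Y : Type*}

/-- `k`-fold iterate of an operator `X → X ∪ {0}`. -/
def iter (g : X → Option X) : ℕ → X → Option X
  | 0, x => some x
  | k + 1, x => (g x).bind (iter g k)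

/-- The operator `S_i` of the simple reflection `r_i` of the Weyl group on a regular crystal:
`S_i b = f_i^m b` if `m = ⟨wt b, h_i⟩ ≥ 0`, and `S_i b = e_i^{-m} b` if `m ≤ 0`.
(In a regular crystal these iterates are never `0`, so the default value is not used.) -/
def weyl (C : CrystalData n X) (i : Fin (n - 1)) (b : X) : X :=
  if 0 ≤ coroot i (C.wt b) then (iter (C.f i) (coroot i (C.wt b)).toNat b).getD b
  else (iter (C.e i) (-coroot i (C.wt b)).toNat b).getD b

/-- `ε_α(b) = ε_s(S_{s+1} ⋯ S_{t-1}(b))` for `α = ε_s - ε_t`. -/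
def εRoot (C : CrystalData n X) (α : PosRoot n) (b : X) : ℤ := C.ε α.first (α.act C.weyl b)

/-- `φ_α(b) = φ_s(S_{s+1} ⋯ S_{t-1}(b))` for `α = ε_s - ε_t`. -/
def φRoot (C : CrystalData n X) (α : PosRoot n) (b : X) : ℤ := C.φ α.first (α.act C.weyl b)

/-- The crystal `[n] = B(ε_1)` of the natural representation. -/
def nat (n : ℕ) : CrystalData n (Fin n) where
  wt j := Pi.single j 1
  ε i j := if j = hi i then 1 else 0
  φ i j := if j = lo i then 1 else 0
  e i j := if j = hi i then some (lo i) else none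
  f i j := if j = lo i then some (hi i) else none

/-- The dual crystal (on the same underlying set). -/
def dual (C : CrystalData n X) : CrystalData n X where
  wt x := -C.wt x
  ε := C.φ
  φ := C.ε
  e := C.f
  f := C.e

/-- The disjoint union of two crystals. -/
def union (C : CrystalData n X) (D : CrystalData n Y) : CrystalData n (X ⊕ Y) where
  wt := Sum.elim C.wt D.wt
  ε i := Sum.elim (C.ε i) (D.ε i)
  φ i := Sum.elim (C.φ i) (D.φ i)
  e i := Sum.elim (fun x => (C.e i x).map Sum.inl) (fun y => (D.e i y).map Sum.inr)
  f i := Sum.elim (fun x => (C.f i x).map Sum.inl) (fun y => (D.f i y).map Sum.inr)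

/-- The disjoint union of copies of one crystal, labelled by the elements of `τ`. -/
def copies (τ : Type*) (C : CrystalData n X) : CrystalData n (τ × X) where
  wt x := C.wt x.2
  ε i x := C.ε i x.2
  φ i x := C.φ i x.2
  e i x := (C.e i x.2).map (Prod.mk x.1)
  f i x := (C.f i x.2).map (Prod.mk x.1)

section words

variable (C : CrystalData n X)

/-- Weight of `x_1 ⊗ ⋯ ⊗ x_r`. -/
def wordWt : List X → Fin n → ℤ
  | [] => 0
  | x :: l => C.wt x + wordWt l

/-- `ε_i(x_1 ⊗ (x_2 ⊗ ⋯))`, by the tensor product rule. -/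
def wordε (i : Fin (n - 1)) : List X → ℤ
  | [] => 0
  | x :: l => max (C.ε i x) (wordε i l - coroot i (C.wt x))

/-- `φ_i(x_1 ⊗ (x_2 ⊗ ⋯))`, by the tensor product rule. -/
def wordφ (i : Fin (n - 1)) : List X → ℤ
  | [] => 0
  | x :: l => max (C.φ i x + coroot i (C.wordWt l)) (wordφ i l)

/-- `e_i(x_1 ⊗ (x_2 ⊗ ⋯))`, by the tensor product rule. -/
def wordE (i : Fin (n - 1)) : List X → Option (List X)
  | [] => none
  | x :: l =>
    if C.wordε i l ≤ C.φ i x then (C.e i x).map (· :: l) else (wordE i l).map (x :: ·)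

/-- `f_i(x_1 ⊗ (x_2 ⊗ ⋯))`, by the tensor product rule. -/
def wordF (i : Fin (n - 1)) : List X → Option (List X)
  | [] => none
  | x :: l =>
    if C.wordε i l < C.φ i x then (C.f i x).map (· :: l) else (wordF i l).map (x :: ·)

/-- The crystal of words `x_1 ⋯ x_r`, identified with `x_1 ⊗ ⋯ ⊗ x_r`, over a crystal; that is,
the disjoint union over `r ≥ 0` of the `r`-fold tensor powers. The empty word spans the trivial
crystal. -/
def words : CrystalData n (List X) where
  wt := C.wordWt
  ε := C.wordε
  φ := C.wordφ
  e := C.wordE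
  f := C.wordF

end words

open Classical in
/-- The structure obtained on `Y` by identifying `y` with `g y`, an element of a crystal: `e_i y` is
the element `y'` with `g y' = e_i (g y)`, and likewise for `f_i`. It is used for injective `g`
whose image is stable under `e_i` and `f_i`, see `IsStrictEmbedding`. -/
noncomputable def pullback (C : CrystalData n X) (g : Y → X) : CrystalData n Y where
  wt y := C.wt (g y)
  ε i y := C.ε i (g y)
  φ i y := C.φ i (g y)
  e i y := if h : ∃ y', C.e i (g y) = some (g y') then some h.choose else none
  f i y := if h : ∃ y', C.f i (g y) = some (g y') then some h.choose else none

/-- `g` embeds the crystal `D` into `C` as a union of connected components. -/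
structure IsStrictEmbedding (D : CrystalData n Y) (C : CrystalData n X) (g : Y → X) : Prop where
  injective : Function.Injective g
  wt_eq : ∀ y, C.wt (g y) = D.wt y
  ε_eq : ∀ i y, C.ε i (g y) = D.ε i y
  φ_eq : ∀ i y, C.φ i (g y) = D.φ i y
  e_eq : ∀ i y, C.e i (g y) = (D.e i y).map g
  f_eq : ∀ i y, C.f i (g y) = (D.f i y).map g

/-- The laws of an `A_{n-1}`-crystal (with `ε_i`, `φ_i` never `-∞`). -/
structure IsCrystal (C : CrystalData n X) : Prop where
  φ_sub_ε : ∀ i b, C.φ i b = C.ε i b + coroot i (C.wt b)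
  wt_e : ∀ i b b', C.e i b = some b' → C.wt b' = C.wt b + simpleRoot i
  wt_f : ∀ i b b', C.f i b = some b' → C.wt b' = C.wt b - simpleRoot i
  ε_e : ∀ i b b', C.e i b = some b' → C.ε i b' = C.ε i b - 1
  φ_e : ∀ i b b', C.e i b = some b' → C.φ i b' = C.φ i b + 1
  ε_f : ∀ i b b', C.f i b = some b' → C.ε i b' = C.ε i b + 1
  φ_f : ∀ i b b', C.f i b = some b' → C.φ i b' = C.φ i b - 1
  f_eq_iff : ∀ i b b', C.f i b = some b' ↔ C.e i b' = some b

/-- `b'` lies in the connected component of `b` in the crystal graph. -/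
def Connected (C : CrystalData n X) : X → X → Prop :=
  Relation.EqvGen fun x y => ∃ i, C.f i x = some y ∨ C.e i x = some y

/-- Crystal equivalence `b ≡ c`: there is an isomorphism of crystals between the connected
components of `b` and `c` that takes `b` to `c`. -/
def Equivalent (C : CrystalData n X) (D : CrystalData n Y) (b : X) (c : Y) : Prop :=
  ∃ ψ : {x // C.Connected b x} ≃ {y // D.Connected c y},
    ψ ⟨b, Relation.EqvGen.refl b⟩ = ⟨c, Relation.EqvGen.refl c⟩ ∧
    (∀ x, D.wt (ψ x).1 = C.wt x.1) ∧
    (∀ i x, D.ε i (ψ x).1 = C.ε i x.1 ∧ D.φ i (ψ x).1 = C.φ i x.1) ∧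
    (∀ i x x', C.e i x.1 = some x'.1 ↔ D.e i (ψ x).1 = some (ψ x').1) ∧
    (∀ i x x', C.f i x.1 = some x'.1 ↔ D.f i (ψ x).1 = some (ψ x').1)

/-- Regular `A_{n-1}`-crystals: crystals in which `ε_i` and `φ_i` are the lengths of the strings and
all of whose connected components are crystals of finite-dimensional irreducible modules. The
latter are exactly the connected components of tensor products of copies of `[n]` and of its dual
`[-n]`. -/
structure IsRegular (C : CrystalData n X) : Prop where
  isCrystal : C.IsCrystal
  ε_eq : ∀ i b, ∃ k : ℕ, C.ε i b = k ∧ IsGreatest {k | iter (C.e i) k b ≠ none} k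
  φ_eq : ∀ i b, ∃ k : ℕ, C.φ i b = k ∧ IsGreatest {k | iter (C.f i) k b ≠ none} k
  component : ∀ b, ∃ w : List (Fin n ⊕ Fin n),
    C.Equivalent ((nat n).union (nat n).dual).words b w

end CrystalData

/-! ### Level one parabolically semistandard tableaux -/

/-- A one-row semistandard tableau with entries in the `ℤ/2`-graded ordered set `(A, p)`, given by its
entries from left to right: they increase weakly, and odd entries do not repeat. -/
structure Row {A : Type*} [LinearOrder A] (p : A → ZMod 2) where
  entries : List A
  sst : entries.Pairwise fun x y => x < y ∨ (x = y ∧ p x = 0)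

namespace Row

variable {A : Type*} [LinearOrder A] {p : A → ZMod 2}

theorem count_le (R : Row p) (a : A) (ha : p a ≠ 0) : R.entries.count a ≤ 1 := by
  obtain ⟨l, hl⟩ := R
  induction l with
  | nil => simp
  | cons x l ih =>
    rw [List.pairwise_cons] at hl
    by_cases hx : x = a
    · subst hx
      have : x ∉ l := fun hm => by
        rcases hl.1 x hm with h | h
        · exact lt_irrefl _ h
        · exact ha h.2
      simp [List.count_eq_zero_of_not_mem this]
    · simpa [List.count_cons, hx] using ih hl.2

/-- The tableau with a given multiset of entries. -/
def ofMultiset (s : Multiset A) (h : ∀ a, p a ≠ 0 → s.count a ≤ 1) : Row p where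
  entries := s.sort
  sst := by
    have h1 : (s.sort).Pairwise (· ≤ ·) := Multiset.pairwise_sort s (· ≤ ·)
    have h2 : ∀ a, p a ≠ 0 → (s.sort).count a ≤ 1 := fun a ha => by
      have := h a ha
      rwa [← Multiset.sort_eq s (· ≤ ·), Multiset.coe_count] at this
    generalize s.sort = l at h1 h2
    induction l with
    | nil => exact List.Pairwise.nil
    | cons x l ih =>
      rw [List.pairwise_cons] at h1 ⊢
      refine ⟨fun y hy => ?_, ih h1.2 fun a ha => le_trans ?_ (h2 a ha)⟩
      · rcases lt_or_eq_of_le (h1.1 y hy) with h | h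
        · exact Or.inl h
        · refine Or.inr ⟨h, ?_⟩
          by_contra hx
          have h3 := h2 x hx
          subst h
          have h4 := List.count_pos_iff.mpr hy
          rw [List.count_cons_self] at h3
          omega
      · exact (List.sublist_cons_self x l).count_le a

/-- Remove entries. -/
def remove (R : Row p) (Y : Multiset A) : Row p :=
  ofMultiset ((R.entries : Multiset A) - Y) fun a ha => by
    have := R.count_le a ha
    rw [Multiset.count_sub, Multiset.coe_count]
    omega

/-- Insert entries and rearrange; no odd entry may get repeated. -/
def insert (R : Row p) (Y : Multiset A)
    (h : ∀ a, p a ≠ 0 → R.entries.count a + Y.count a ≤ 1) : Row p :=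
  ofMultiset ((R.entries : Multiset A) + Y) fun a ha => by
    rw [Multiset.count_add, Multiset.coe_count]
    exact h a ha

end Row

variable {A B : Type*} [LinearOrder A] [LinearOrder B]

/-- The set `𝓕` of parabolically semistandard tableaux `(T⁺, T⁻)` of level one with respect to
`(A, B)`: pairs of a one-row tableau over `A` and a one-row tableau over `B` (rows are taken up to
horizontal translation). -/
structure Fock (pA : A → ZMod 2) (pB : B → ZMod 2) where
  pos : Row pA
  neg : Row pB

variable {pA : A → ZMod 2} {pB : B → ZMod 2}

namespace Fock

/-- The shape `k ∈ ℤ` of `T`, so that `T` belongs to `SST_{A/B}(k)`. -/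
def shape (T : Fock pA pB) : ℤ := T.pos.entries.length - T.neg.entries.length

/-- The multiplicity in `T` of the entry `a ∈ A`, respectively `b ∈ B`. -/
def mult (T : Fock pA pB) : A ⊕ B → ℕ :=
  Sum.elim (fun a => T.pos.entries.count a) (fun b => T.neg.entries.count b)

end Fock

/-- The finite subset `sA ⊔ sB` of `A ⊔ B` listed in the order
`a_k > ⋯ > a_1` (in `A`), followed by `b_1 < ⋯ < b_l` (in `B`). -/
def rowOrder (sA : Finset A) (sB : Finset B) : List (A ⊕ B) :=
  (sA.sort (· ≥ ·)).map Sum.inl ++ (sB.sort (· ≤ ·)).map Sum.inr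

/-! ### Local energy and combinatorial `R`-matrix -/

/-- The block `s_c` of signs (`true` is `+`, `false` is `-`) for `c ∈ A ⊔ B`. Every sign carries the
entry `c` to which it corresponds. -/
def signBlock (T₁ T₂ : Fock pA pB) : A ⊕ B → List (Bool × (A ⊕ B))
  | .inl a =>
    if pA a = 0 then
      List.replicate (T₂.mult (.inl a)) (false, .inl a) ++
        List.replicate (T₁.mult (.inl a)) (true, .inl a)
    else
      List.replicate (T₁.mult (.inl a)) (true, .inl a) ++
        List.replicate (T₂.mult (.inl a)) (false, .inl a)
  | .inr b =>
    if pB b = 0 then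
      List.replicate (T₁.mult (.inr b)) (false, .inr b) ++
        List.replicate (T₂.mult (.inr b)) (true, .inr b)
    else
      List.replicate (T₂.mult (.inr b)) (true, .inr b) ++
        List.replicate (T₁.mult (.inr b)) (false, .inr b)

/-- The sequence of signs `s = s_{T₁,T₂}`. -/
def signs (T₁ T₂ : Fock pA pB) : List (Bool × (A ⊕ B)) :=
  (rowOrder (T₁.pos.entries.toFinset ∪ T₂.pos.entries.toFinset)
    (T₁.neg.entries.toFinset ∪ T₂.neg.entries.toFinset)).flatMap (signBlock T₁ T₂)

/-- Put a sign in front of a reduced sequence, cancelling a pair `(+ -)` if one arises. -/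
def consReduce {τ : Type*} (x : Bool × τ) : List (Bool × τ) → List (Bool × τ)
  | [] => [x]
  | y :: l => if x.1 = true ∧ y.1 = false then l else x :: y :: l

/-- Cancel adjacent pairs `(+ -)` as far as possible. -/
def reduce {τ : Type*} (l : List (Bool × τ)) : List (Bool × τ) := l.foldr consReduce []

/-- The reduced sequence of signs `s^red = (- ⋯ - + ⋯ +)`. -/
def reducedSigns (T₁ T₂ : Fock pA pB) : List (Bool × (A ⊕ B)) := reduce (signs T₁ T₂)

/-- The entries that correspond to the signs `+` in `s^red`, from left to right. -/
def plusEntries (T₁ T₂ : Fock pA pB) : List (A ⊕ B) :=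
  ((reducedSigns T₁ T₂).filter fun x => x.1 = true).map Prod.snd

/-- The entries that correspond to the signs `-` in `s^red`, from left to right. -/
def minusEntries (T₁ T₂ : Fock pA pB) : List (A ⊕ B) :=
  ((reducedSigns T₁ T₂).filter fun x => x.1 = false).map Prod.snd

/-- The local energy function `H(T₁, T₂) = - min {#(-), #(+)}`, counted in `s^red`. -/
def localEnergy (T₁ T₂ : Fock pA pB) : ℤ :=
  -min ((minusEntries T₁ T₂).length : ℤ) ((plusEntries T₁ T₂).length : ℤ)

/-- The elements of `A` in a list of elements of `A ⊔ B`, with multiplicity. -/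
def inA (l : List (A ⊕ B)) : Multiset A := (l.filterMap Sum.getLeft? : List A)

/-- The elements of `B` in a list of elements of `A ⊔ B`, with multiplicity. -/
def inB (l : List (A ⊕ B)) : Multiset B := (l.filterMap Sum.getRight? : List B)

/-! The following facts show that the moves below lead to semistandard tableaux. -/

instance {α β : Type*} [BEq α] [LawfulBEq α] [BEq β] [LawfulBEq β] : LawfulBEq (α ⊕ β) where
  eq_of_beq {a b} h := by
    rcases a with a | a <;> rcases b with b | b
    · exact congrArg Sum.inl (eq_of_beq (show (a == b) = true from h))
    · exact absurd (show false = true from h) Bool.false_ne_true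
    · exact absurd (show false = true from h) Bool.false_ne_true
    · exact congrArg Sum.inr (eq_of_beq (show (a == b) = true from h))
  rfl {a} := by
    rcases a with a | a
    · exact (beq_self_eq_true a : (a == a) = true)
    · exact (beq_self_eq_true a : (a == a) = true)

theorem reduce_sublist {τ : Type*} (l : List (Bool × τ)) : (reduce l).Sublist l := by
  induction l with
  | nil => exact List.Sublist.refl _
  | cons x l ih =>
    have h : ∀ m : List (Bool × τ), (consReduce x m).Sublist (x :: m) := by
      intro m
      cases m with
      | nil => exact List.Sublist.refl _
      | cons y l' =>
        rw [consReduce]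
        by_cases hxy : x.1 = true ∧ y.1 = false
        · rw [if_pos hxy]
          exact (List.sublist_cons_self y l').trans (List.sublist_cons_self x _)
        · rw [if_neg hxy]
    exact (h _).trans (ih.cons_cons x)

theorem reduce_cancel {τ : Type*} (l₁ l₂ : List (Bool × τ)) (c d : τ) :
    reduce (l₁ ++ (true, c) :: (false, d) :: l₂) = reduce (l₁ ++ l₂) := by
  have h : consReduce (true, c) (consReduce (false, d) (reduce l₂)) = reduce l₂ := by
    cases reduce l₂ <;> simp [consReduce]
  unfold reduce at h ⊢
  simp only [List.foldr_append, List.foldr_cons, h]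

theorem count_reduce {τ : Type*} [BEq τ] [LawfulBEq τ] (l₁ l₂ : List (Bool × τ)) (c : τ) (p q : ℕ)
    (hp : p ≤ 1) (hq : q ≤ 1) (h₁ : ∀ x ∈ l₁, x.2 ≠ c) (h₂ : ∀ x ∈ l₂, x.2 ≠ c) :
    let r := reduce (l₁ ++ ((List.replicate p (true, c) ++ List.replicate q (false, c)) ++ l₂))
    r.count (true, c) + q ≤ 1 ∧ r.count (false, c) + p ≤ 1 := by
  have z₁ : ∀ b, l₁.count (b, c) = 0 := fun b =>
    List.count_eq_zero_of_not_mem fun h => h₁ _ h rfl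
  have z₂ : ∀ b, l₂.count (b, c) = 0 := fun b =>
    List.count_eq_zero_of_not_mem fun h => h₂ _ h rfl
  intro r
  have hr : ∀ b, r.count (b, c) ≤ _ := fun b => (reduce_sublist _).count_le (b, c)
  have ht := hr true
  have hf := hr false
  simp only [List.count_append, z₁, z₂, List.count_replicate] at ht hf
  simp at ht hf
  by_cases hpq : p = 1 ∧ q = 1
  · obtain ⟨rfl, rfl⟩ := hpq
    have h0 : ∀ b, r.count (b, c) = 0 := fun b => by
      have h := (reduce_sublist (l₁ ++ l₂)).count_le (b, c)
      rw [← reduce_cancel l₁ l₂ c c] at h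
      simp only [List.count_append, z₁, z₂] at h
      exact Nat.le_zero.mp h
    simp [h0]
  · omega

theorem count_snd_filter {τ : Type*} [BEq τ] [LawfulBEq τ] (l : List (Bool × τ)) (b : Bool) (c : τ) :
    ((l.filter fun x => x.1 = b).map Prod.snd).count c = l.count (b, c) := by
  induction l with
  | nil => rfl
  | cons x l ih =>
    obtain ⟨d, y⟩ := x
    by_cases hd : d = b
    · subst hd
      by_cases hy : y = c <;> simp_all
    · simp_all

theorem mem_signBlock {T₁ T₂ : Fock pA pB} {c : A ⊕ B} {x : Bool × (A ⊕ B)}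
    (h : x ∈ signBlock T₁ T₂ c) : x.2 = c := by
  rcases c with a | b
  · by_cases ha : pA a = 0 <;> simp only [signBlock, ha, if_true, if_false] at h <;>
      rcases List.mem_append.mp h with h | h <;> rw [List.eq_of_mem_replicate h]
  · by_cases hb : pB b = 0 <;> simp only [signBlock, hb, if_true, if_false] at h <;>
      rcases List.mem_append.mp h with h | h <;> rw [List.eq_of_mem_replicate h]

theorem rowOrder_nodup (sA : Finset A) (sB : Finset B) : (rowOrder sA sB).Nodup := by
  unfold rowOrder
  refine List.Nodup.append ((Finset.sort_nodup _ _).map Sum.inl_injective)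
    ((Finset.sort_nodup _ _).map Sum.inr_injective) ?_
  intro x h1 h2
  obtain ⟨a, -, rfl⟩ := List.mem_map.mp h1
  obtain ⟨b, -, h⟩ := List.mem_map.mp h2
  cases h

theorem count_entries (T₁ T₂ : Fock pA pB) (c : A ⊕ B) (p q : ℕ) (hp : p ≤ 1) (hq : q ≤ 1)
    (hc : signBlock T₁ T₂ c = List.replicate p (true, c) ++ List.replicate q (false, c))
    (h0 : c ∉ rowOrder (T₁.pos.entries.toFinset ∪ T₂.pos.entries.toFinset)
      (T₁.neg.entries.toFinset ∪ T₂.neg.entries.toFinset) → p = 0 ∧ q = 0) :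
    (plusEntries T₁ T₂).count c + q ≤ 1 ∧ (minusEntries T₁ T₂).count c + p ≤ 1 := by
  unfold plusEntries minusEntries
  rw [count_snd_filter, count_snd_filter]
  unfold reducedSigns signs
  have hn := rowOrder_nodup (T₁.pos.entries.toFinset ∪ T₂.pos.entries.toFinset)
      (T₁.neg.entries.toFinset ∪ T₂.neg.entries.toFinset)
  revert hn h0
  generalize rowOrder (T₁.pos.entries.toFinset ∪ T₂.pos.entries.toFinset)
      (T₁.neg.entries.toFinset ∪ T₂.neg.entries.toFinset) = L
  intro h0 hn
  have key : ∀ M : List (A ⊕ B), c ∉ M → ∀ x ∈ M.flatMap (signBlock T₁ T₂), x.2 ≠ c := by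
    intro M hM x hx hxc
    obtain ⟨d, hd, hxd⟩ := List.mem_flatMap.mp hx
    rw [mem_signBlock hxd] at hxc
    exact hM (hxc ▸ hd)
  by_cases hm : c ∈ L
  · obtain ⟨M, N, rfl⟩ := List.append_of_mem hm
    have hM : c ∉ M := fun h => (List.nodup_append.mp hn).2.2 c h c List.mem_cons_self rfl
    have hN : c ∉ N := (List.nodup_cons.mp (List.nodup_append.mp hn).2.1).1
    rw [List.flatMap_append, List.flatMap_cons, hc]
    exact count_reduce _ _ c p q hp hq (key M hM) (key N hN)
  · obtain ⟨rfl, rfl⟩ := h0 hm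
    have h := count_reduce (L.flatMap (signBlock T₁ T₂)) [] c 0 0 hp hq (key L hm) (by simp)
    simpa using h

theorem mem_rowOrder (sA : Finset A) (sB : Finset B) (c : A ⊕ B) :
    c ∈ rowOrder sA sB ↔ Sum.elim (· ∈ sA) (· ∈ sB) c := by
  rcases c with a | b <;> simp [rowOrder]

theorem count_entries_inl (T₁ T₂ : Fock pA pB) (a : A) (ha : pA a ≠ 0) :
    (plusEntries T₁ T₂).count (.inl a) + T₂.pos.entries.count a ≤ 1 ∧
      (minusEntries T₁ T₂).count (.inl a) + T₁.pos.entries.count a ≤ 1 := by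
  refine count_entries T₁ T₂ (.inl a) _ _ (T₁.pos.count_le a ha) (T₂.pos.count_le a ha) ?_ ?_
  · simp [signBlock, ha, Fock.mult]
  · intro h
    rw [mem_rowOrder] at h
    simp at h
    exact ⟨List.count_eq_zero_of_not_mem h.1, List.count_eq_zero_of_not_mem h.2⟩

theorem count_entries_inr (T₁ T₂ : Fock pA pB) (b : B) (hb : pB b ≠ 0) :
    (plusEntries T₁ T₂).count (.inr b) + T₁.neg.entries.count b ≤ 1 ∧
      (minusEntries T₁ T₂).count (.inr b) + T₂.neg.entries.count b ≤ 1 := by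
  refine count_entries T₁ T₂ (.inr b) _ _ (T₂.neg.count_le b hb) (T₁.neg.count_le b hb) ?_ ?_
  · simp [signBlock, hb, Fock.mult]
  · intro h
    rw [mem_rowOrder] at h
    simp at h
    exact ⟨List.count_eq_zero_of_not_mem h.2, List.count_eq_zero_of_not_mem h.1⟩

theorem count_inA (l : List (A ⊕ B)) (a : A) : (inA l).count a = l.count (.inl a) := by
  unfold inA
  rw [Multiset.coe_count]
  induction l with
  | nil => rfl
  | cons x l ih => rcases x with x | x <;> simp [List.filterMap_cons, List.count_cons, ih]

theorem count_inB (l : List (A ⊕ B)) (b : B) : (inB l).count b = l.count (.inr b) := by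
  unfold inB
  rw [Multiset.coe_count]
  induction l with
  | nil => rfl
  | cons x l ih => rcases x with x | x <;> simp [List.filterMap_cons, List.count_cons, ih]

/-- The entries `y_1, …, y_{k₁-k₂}`: those of the first `k₁ - k₂` signs `+` from the left. -/
def movesPlus (T₁ T₂ : Fock pA pB) : List (A ⊕ B) :=
  (plusEntries T₁ T₂).take (T₁.shape - T₂.shape).toNat

/-- The entries `x_1, …, x_{k₂-k₁}`: those of the first `k₂ - k₁` signs `-` from the right. -/
def movesMinus (T₁ T₂ : Fock pA pB) : List (A ⊕ B) :=
  (minusEntries T₁ T₂).reverse.take (T₂.shape - T₁.shape).toNat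

theorem count_movesPlus (T₁ T₂ : Fock pA pB) (c : A ⊕ B) :
    (movesPlus T₁ T₂).count c ≤ (plusEntries T₁ T₂).count c :=
  (List.take_sublist _ _).count_le c

theorem count_movesMinus (T₁ T₂ : Fock pA pB) (c : A ⊕ B) :
    (movesMinus T₁ T₂).count c ≤ (minusEntries T₁ T₂).count c := by
  have h := (List.take_sublist (T₂.shape - T₁.shape).toNat (minusEntries T₁ T₂).reverse).count_le c
  rwa [List.count_reverse] at h

/-- The combinatorial `R`-matrix `(T₁, T₂) ↦ (T₂', T₁')` for `T₁ ∈ SST_{A/B}(k₁)`,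
`T₂ ∈ SST_{A/B}(k₂)`. It is the identity if `k₁ = k₂`. If `k₁ > k₂`, the entries `y_k` move from
`T₁⁺` to `T₂⁺` (when in `A`), or from `T₂⁻` to `T₁⁻` (when in `B`). If `k₁ < k₂`, the entries `x_k`
move from `T₂⁺` to `T₁⁺`, or from `T₁⁻` to `T₂⁻`. -/
def rMatrix (T₁ T₂ : Fock pA pB) : Fock pA pB × Fock pA pB :=
  if T₁.shape = T₂.shape then (T₁, T₂)
  else if T₁.shape > T₂.shape then
    (⟨T₁.pos.remove (inA (movesPlus T₁ T₂)),
      T₁.neg.insert (inB (movesPlus T₁ T₂)) fun b hb => by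
        have h1 := (count_entries_inr T₁ T₂ b hb).1
        have h2 := count_movesPlus T₁ T₂ (.inr b)
        rw [count_inB]; omega⟩,
     ⟨T₂.pos.insert (inA (movesPlus T₁ T₂)) fun a ha => by
        have h1 := (count_entries_inl T₁ T₂ a ha).1
        have h2 := count_movesPlus T₁ T₂ (.inl a)
        rw [count_inA]; omega,
      T₂.neg.remove (inB (movesPlus T₁ T₂))⟩)
  else
    (⟨T₁.pos.insert (inA (movesMinus T₁ T₂)) fun a ha => by
        have h1 := (count_entries_inl T₁ T₂ a ha).2
        have h2 := count_movesMinus T₁ T₂ (.inl a)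
        rw [count_inA]; omega,
      T₁.neg.remove (inB (movesMinus T₁ T₂))⟩,
     ⟨T₂.pos.remove (inA (movesMinus T₁ T₂)),
      T₂.neg.insert (inB (movesMinus T₁ T₂)) fun b hb => by
        have h1 := (count_entries_inr T₁ T₂ b hb).2
        have h2 := count_movesMinus T₁ T₂ (.inr b)
        rw [count_inB]; omega⟩)

/-! ### The set `𝓕ⁿ` -/

/-- The `n`-fold product `𝓕ⁿ`, with elements `T = (T_1, …, T_n)`. -/
abbrev FockPow (pA : A → ZMod 2) (pB : B → ZMod 2) (n : ℕ) : Type _ := Fin n → Fock pA pB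

namespace FockPow

variable {n : ℕ}

/-- `H_i(T) = H(T_i, T_{i+1})`. -/
def energyAt (i : Fin (n - 1)) (T : FockPow pA pB n) : ℤ := localEnergy (T (lo i)) (T (hi i))

/-- `ς_i` replaces `(T_i, T_{i+1})` by its image under the combinatorial `R`-matrix. -/
def rAt (i : Fin (n - 1)) (T : FockPow pA pB n) : FockPow pA pB n :=
  Function.update (Function.update T (lo i) (rMatrix (T (lo i)) (T (hi i))).1)
    (hi i) (rMatrix (T (lo i)) (T (hi i))).2

/-- The combinatorial energy function
`D(T) = ∑_{s < t} H_s(ς_{s+1} ς_{s+2} ⋯ ς_{t-1}(T))`. -/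
def energy (T : FockPow pA pB n) : ℤ := ∑ α : PosRoot n, energyAt α.first (α.act rAt T)

/-- The matrix `(m_{cj})`, `c ∈ A ⊔ B`, `j ∈ [n]`, of `T`: `m_{cj}` is the multiplicity of `c` in
`T_j`. -/
def mat (T : FockPow pA pB n) (c : A ⊕ B) (j : Fin n) : ℕ := (T j).mult c

/-- The column reading word of the tableau `T^{(c)}` that is given by the row `m_{(c)}`.
For `c ∈ A` the entries of `T^{(c)}` are `1^{m_{c1}} 2^{m_{c2}} ⋯ n^{m_{cn}}` in increasing order, and
for `c ∈ B` they are `(-n)^{m_{cn}} ⋯ (-1)^{m_{c1}}`. The shape is a row if `c` is even, so that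
columns are read from right to left, and a column, read from top to bottom, if `c` is odd.
The letter `inl (a, j)` is `j ∈ [n]` and the letter `inr (b, j)` is `-j ∈ [-n]`; the label `a` or `b`
records the tensor factor. -/
def rowWord (T : FockPow pA pB n) : A ⊕ B → List ((A × Fin n) ⊕ (B × Fin n))
  | .inl a =>
    let entries := (List.finRange n).flatMap fun j =>
      List.replicate (T.mat (.inl a) j) (Sum.inl (a, j))
    if pA a = 0 then entries.reverse else entries
  | .inr b =>
    let entries := (List.finRange n).reverse.flatMap fun j =>
      List.replicate (T.mat (.inr b) j) (Sum.inr (b, j))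
    if pB b = 0 then entries.reverse else entries

/-- The word of `⨂_{a ∈ A, decreasing} T^{(a)} ⊗ ⨂_{b ∈ B, increasing} T^{(b)}`
(over the finitely many `a`, `b` that occur in `T`). -/
def word (T : FockPow pA pB n) : List ((A × Fin n) ⊕ (B × Fin n)) :=
  (rowOrder (Finset.univ.biUnion fun j => (T j).pos.entries.toFinset)
    (Finset.univ.biUnion fun j => (T j).neg.entries.toFinset)).flatMap T.rowWord

end FockPow

/-- The crystal of words in labelled letters: copies of `[n]` labelled by `A` and copies of the
dual `[-n]` labelled by `B`. The labels are inert. -/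
def labelledWords (A B : Type*) (n : ℕ) :
    CrystalData n (List ((A × Fin n) ⊕ (B × Fin n))) :=
  (((CrystalData.nat n).copies A).union ((CrystalData.nat n).dual.copies B)).words

/-- The `A_{n-1}`-crystal structure on `𝓕ⁿ`: `T` is identified with
`⨂_{a ∈ A, decreasing} T^{(a)} ⊗ ⨂_{b ∈ B, increasing} T^{(b)}`. -/
noncomputable def fockCrystal (pA : A → ZMod 2) (pB : B → ZMod 2) (n : ℕ) :
    CrystalData n (FockPow pA pB n) :=
  (labelledWords A B n).pullback FockPow.word

end FockCrystal

/-! The tensor product rule is a signature rule. A letter of `[n]` or `[-n]` has `(φ_i, ε_i)` equal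
to `(1, 0)`, `(0, 1)` or `(0, 0)`, so for the index `i` it contributes a sign `+`, a sign `-` or
nothing. Once all pairs `(+ -)` are cancelled, a word retains `ε_i` signs `-` followed by `φ_i`
signs `+`, and `f_i` acts on the letter of the leftmost remaining `+`, whose sign becomes `-`
(`wordSigns_eq`, `wordF_eq_some`).

The words that come from `𝓕ⁿ` are exactly those whose letters are sorted for the order `Letter.Rel`
(`FockPow.pairwise_word`, `FockPow.exists_word_eq`), and the multiplicities are recovered by
counting letters, so the identification is injective. When `f_i` changes a letter, its left
neighbour carries no `+` and its right neighbour no `-`. Such neighbours compare with the new letter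
as they did with the old one, so sortedness is preserved in both directions
(`Letter.pairwise_f_iff`). This gives stability under `f_i`, and under `e_i` as its partial inverse.

For regularity, forgetting the labels is a strict morphism to words over `[n] ⊔ [-n]`. The operators
never alter the sequence of labels, so this morphism is injective on each connected component and
identifies it with a component of words.

For the energy and the `R`-matrix, the sequence `s` of `(T_i, T_{i+1})` and the signs read off the
word of `T` are both sorted for an antisymmetric relation and contain every signed entry equally
often; hence they agree (`FockPow.reducedSigns_eq`). So `ε_i` and `φ_i` count the signs in `s^red`,
which gives `H_i`. Applying `f_i` repeatedly moves the entries of the leftmost signs `+` one at a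
time, and `e_i` those of the rightmost signs `-`. The exponent in `S_i` is the difference of the
shapes of `T_i` and `T_{i+1}`, so `S_i = ς_i`, and the formula for `D` follows term by term. -/

namespace FockCrystal

/-! ### Pairing with the simple coroots -/

section coroot

variable {n : ℕ} (i : Fin (n - 1))

theorem lo_ne_hi : lo i ≠ hi i := fun h => by
  have := congrArg Fin.val h
  simp [lo, hi] at this

@[simp] theorem coroot_zero : coroot i 0 = 0 := by simp [coroot]

@[simp] theorem coroot_add (v w : Fin n → ℤ) : coroot i (v + w) = coroot i v + coroot i w := by
  simp only [coroot, Pi.add_apply]; ring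

@[simp] theorem coroot_sub (v w : Fin n → ℤ) : coroot i (v - w) = coroot i v - coroot i w := by
  simp only [coroot, Pi.sub_apply]; ring

@[simp] theorem coroot_neg (v : Fin n → ℤ) : coroot i (-v) = -coroot i v := by
  simp only [coroot, Pi.neg_apply]; ring

@[simp] theorem coroot_simpleRoot : coroot i (simpleRoot i) = 2 := by
  simp [coroot, simpleRoot, lo_ne_hi i, (lo_ne_hi i).symm]

end coroot

/-! ### Seminormal and minuscule crystals -/

namespace CrystalData

variable {n : ℕ} {X Y Z : Type*}

/-- `ε_i` and `φ_i` are nonnegative, and vanish exactly where `e_i` and `f_i` do. -/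
structure IsSeminormal (C : CrystalData n X) : Prop where
  ε_nonneg : ∀ i b, 0 ≤ C.ε i b
  φ_nonneg : ∀ i b, 0 ≤ C.φ i b
  e_eq_none : ∀ i b, C.e i b = none ↔ C.ε i b = 0
  f_eq_none : ∀ i b, C.f i b = none ↔ C.φ i b = 0

/-- All strings have length at most one. -/
def IsMinuscule (C : CrystalData n X) : Prop := ∀ i b, C.ε i b + C.φ i b ≤ 1

/-! ### Elementary constructions -/

theorem nat_isCrystal (n : ℕ) : (nat n).IsCrystal where
  φ_sub_ε i b := by
    have := lo_ne_hi i
    by_cases h1 : b = lo i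
    · subst h1; simp [nat, coroot, this, this.symm]
    · by_cases h2 : b = hi i
      · subst h2; simp [nat, coroot, this, this.symm]
      · simp [nat, coroot, h1, h2, Ne.symm h1, Ne.symm h2]
  wt_e i b b' h := by
    simp only [nat] at h ⊢
    split_ifs at h with h1
    cases h; subst h1
    simp [simpleRoot]
  wt_f i b b' h := by
    simp only [nat] at h ⊢
    split_ifs at h with h1
    cases h; subst h1
    simp [simpleRoot]
  ε_e i b b' h := by
    simp only [nat] at h ⊢
    split_ifs at h with h1
    cases h; subst h1
    simp [lo_ne_hi]
  φ_e i b b' h := by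
    simp only [nat] at h ⊢
    split_ifs at h with h1
    cases h; subst h1
    simp [(lo_ne_hi i).symm]
  ε_f i b b' h := by
    simp only [nat] at h ⊢
    split_ifs at h with h1
    cases h; subst h1
    simp [lo_ne_hi]
  φ_f i b b' h := by
    simp only [nat] at h ⊢
    split_ifs at h with h1
    cases h; subst h1
    simp [(lo_ne_hi i).symm]
  f_eq_iff i b b' := by
    simp only [nat]
    constructor <;> intro h <;> split_ifs at h with h1 <;> cases h <;> simp [h1]

theorem nat_isSeminormal (n : ℕ) : (nat n).IsSeminormal where
  ε_nonneg i b := by simp only [nat]; split_ifs <;> simp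
  φ_nonneg i b := by simp only [nat]; split_ifs <;> simp
  e_eq_none i b := by simp only [nat]; split_ifs <;> simp
  f_eq_none i b := by simp only [nat]; split_ifs <;> simp

theorem nat_isMinuscule (n : ℕ) : (nat n).IsMinuscule := fun i b => by
  have := lo_ne_hi i
  simp only [nat]
  split_ifs with h1 h2
  · exact absurd (h2.symm.trans h1) this
  all_goals simp

theorem IsCrystal.dual {C : CrystalData n X} (h : C.IsCrystal) : C.dual.IsCrystal where
  φ_sub_ε i b := by
    have := h.φ_sub_ε i b
    simp only [CrystalData.dual, coroot_neg]; omega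
  wt_e i b b' hb := by
    simp only [CrystalData.dual, h.wt_f i b b' hb]; abel
  wt_f i b b' hb := by
    simp only [CrystalData.dual, h.wt_e i b b' hb]; abel
  ε_e := h.φ_f
  φ_e := h.ε_f
  ε_f := h.φ_e
  φ_f := h.ε_e
  f_eq_iff i b b' := (h.f_eq_iff i b' b).symm

theorem IsSeminormal.dual {C : CrystalData n X} (h : C.IsSeminormal) : C.dual.IsSeminormal where
  ε_nonneg := h.φ_nonneg
  φ_nonneg := h.ε_nonneg
  e_eq_none := h.f_eq_none
  f_eq_none := h.e_eq_none

theorem IsMinuscule.dual {C : CrystalData n X} (h : C.IsMinuscule) : C.dual.IsMinuscule :=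
  fun i b => by
    have := h i b
    simp only [CrystalData.dual]; omega

theorem IsCrystal.copies {C : CrystalData n X} (h : C.IsCrystal) (τ : Type*) :
    (C.copies τ).IsCrystal where
  φ_sub_ε i b := h.φ_sub_ε i b.2
  wt_e i b b' hb := by
    obtain ⟨y, hy, rfl⟩ := Option.map_eq_some_iff.mp hb
    exact h.wt_e i _ _ hy
  wt_f i b b' hb := by
    obtain ⟨y, hy, rfl⟩ := Option.map_eq_some_iff.mp hb
    exact h.wt_f i _ _ hy
  ε_e i b b' hb := by
    obtain ⟨y, hy, rfl⟩ := Option.map_eq_some_iff.mp hb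
    exact h.ε_e i _ _ hy
  φ_e i b b' hb := by
    obtain ⟨y, hy, rfl⟩ := Option.map_eq_some_iff.mp hb
    exact h.φ_e i _ _ hy
  ε_f i b b' hb := by
    obtain ⟨y, hy, rfl⟩ := Option.map_eq_some_iff.mp hb
    exact h.ε_f i _ _ hy
  φ_f i b b' hb := by
    obtain ⟨y, hy, rfl⟩ := Option.map_eq_some_iff.mp hb
    exact h.φ_f i _ _ hy
  f_eq_iff i b b' := by
    obtain ⟨t, x⟩ := b
    obtain ⟨t', x'⟩ := b'
    have := h.f_eq_iff i x x'
    simp only [CrystalData.copies, Option.map_eq_some_iff, Prod.mk.injEq]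
    grind

theorem IsSeminormal.copies {C : CrystalData n X} (h : C.IsSeminormal) (τ : Type*) :
    (C.copies τ).IsSeminormal where
  ε_nonneg i b := h.ε_nonneg i b.2
  φ_nonneg i b := h.φ_nonneg i b.2
  e_eq_none i b := Option.map_eq_none_iff.trans (h.e_eq_none i b.2)
  f_eq_none i b := Option.map_eq_none_iff.trans (h.f_eq_none i b.2)

theorem IsMinuscule.copies {C : CrystalData n X} (h : C.IsMinuscule) (τ : Type*) :
    (C.copies τ).IsMinuscule := fun i b => h i b.2

theorem IsCrystal.union {C : CrystalData n X} {D : CrystalData n Y} (h : C.IsCrystal)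
    (k : D.IsCrystal) : (C.union D).IsCrystal where
  φ_sub_ε i b := by
    cases b
    exacts [h.φ_sub_ε i _, k.φ_sub_ε i _]
  wt_e i b b' hb := by
    cases b <;> obtain ⟨y, hy, rfl⟩ := Option.map_eq_some_iff.mp hb
    exacts [h.wt_e i _ _ hy, k.wt_e i _ _ hy]
  wt_f i b b' hb := by
    cases b <;> obtain ⟨y, hy, rfl⟩ := Option.map_eq_some_iff.mp hb
    exacts [h.wt_f i _ _ hy, k.wt_f i _ _ hy]
  ε_e i b b' hb := by
    cases b <;> obtain ⟨y, hy, rfl⟩ := Option.map_eq_some_iff.mp hb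
    exacts [h.ε_e i _ _ hy, k.ε_e i _ _ hy]
  φ_e i b b' hb := by
    cases b <;> obtain ⟨y, hy, rfl⟩ := Option.map_eq_some_iff.mp hb
    exacts [h.φ_e i _ _ hy, k.φ_e i _ _ hy]
  ε_f i b b' hb := by
    cases b <;> obtain ⟨y, hy, rfl⟩ := Option.map_eq_some_iff.mp hb
    exacts [h.ε_f i _ _ hy, k.ε_f i _ _ hy]
  φ_f i b b' hb := by
    cases b <;> obtain ⟨y, hy, rfl⟩ := Option.map_eq_some_iff.mp hb
    exacts [h.φ_f i _ _ hy, k.φ_f i _ _ hy]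
  f_eq_iff i b b' := by
    cases b <;> cases b' <;>
      simp [CrystalData.union, Option.map_eq_some_iff, h.f_eq_iff, k.f_eq_iff]

theorem IsSeminormal.union {C : CrystalData n X} {D : CrystalData n Y} (h : C.IsSeminormal)
    (k : D.IsSeminormal) : (C.union D).IsSeminormal where
  ε_nonneg i b := by
    cases b
    exacts [h.ε_nonneg i _, k.ε_nonneg i _]
  φ_nonneg i b := by
    cases b
    exacts [h.φ_nonneg i _, k.φ_nonneg i _]
  e_eq_none i b := by
    cases b <;> refine Option.map_eq_none_iff.trans ?_
    exacts [h.e_eq_none i _, k.e_eq_none i _]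
  f_eq_none i b := by
    cases b <;> refine Option.map_eq_none_iff.trans ?_
    exacts [h.f_eq_none i _, k.f_eq_none i _]

theorem IsMinuscule.union {C : CrystalData n X} {D : CrystalData n Y} (h : C.IsMinuscule)
    (k : D.IsMinuscule) : (C.union D).IsMinuscule := fun i b => by
  cases b
  exacts [h i _, k i _]

/-! ### Words over a crystal -/

section words

variable {C : CrystalData n X}

/-- The two maxima run over corresponding terms that differ by the total weight. With this identity,
every law for `φ_i` on words reduces to the one for `ε_i`. -/
theorem IsCrystal.wordφ_eq (h : C.IsCrystal) (i : Fin (n - 1)) (w : List X) :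
    C.wordφ i w = C.wordε i w + coroot i (C.wordWt w) := by
  induction w with
  | nil => simp [wordφ, wordε, wordWt]
  | cons x l ih =>
    have := h.φ_sub_ε i x
    simp only [wordφ, wordε, wordWt, coroot_add]
    omega

theorem IsCrystal.wordWt_e (h : C.IsCrystal) (i : Fin (n - 1)) (w w' : List X)
    (hw : C.wordE i w = some w') : C.wordWt w' = C.wordWt w + simpleRoot i := by
  induction w generalizing w' with
  | nil => simp [wordE] at hw
  | cons x l ih =>
    rw [wordE] at hw
    split_ifs at hw <;> obtain ⟨y, hy, rfl⟩ := Option.map_eq_some_iff.mp hw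
    · simp only [wordWt, h.wt_e i _ _ hy]; abel
    · simp only [wordWt, ih _ hy]; abel

theorem IsCrystal.wordε_e (h : C.IsCrystal) (i : Fin (n - 1)) (w w' : List X)
    (hw : C.wordE i w = some w') : C.wordε i w' = C.wordε i w - 1 := by
  induction w generalizing w' with
  | nil => simp [wordE] at hw
  | cons x l ih =>
    have := h.φ_sub_ε i x
    rw [wordE] at hw
    split_ifs at hw <;> obtain ⟨y, hy, rfl⟩ := Option.map_eq_some_iff.mp hw
    · simp only [wordε, h.wt_e i _ _ hy, h.ε_e i _ _ hy, coroot_add, coroot_simpleRoot]; omega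
    · simp only [wordε, ih _ hy]; omega

theorem IsCrystal.wordWt_f (h : C.IsCrystal) (i : Fin (n - 1)) (w w' : List X)
    (hw : C.wordF i w = some w') : C.wordWt w' = C.wordWt w - simpleRoot i := by
  induction w generalizing w' with
  | nil => simp [wordF] at hw
  | cons x l ih =>
    rw [wordF] at hw
    split_ifs at hw <;> obtain ⟨y, hy, rfl⟩ := Option.map_eq_some_iff.mp hw
    · simp only [wordWt, h.wt_f i _ _ hy]; abel
    · simp only [wordWt, ih _ hy]; abel

theorem IsCrystal.wordε_f (h : C.IsCrystal) (i : Fin (n - 1)) (w w' : List X)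
    (hw : C.wordF i w = some w') : C.wordε i w' = C.wordε i w + 1 := by
  induction w generalizing w' with
  | nil => simp [wordF] at hw
  | cons x l ih =>
    have := h.φ_sub_ε i x
    rw [wordF] at hw
    split_ifs at hw <;> obtain ⟨y, hy, rfl⟩ := Option.map_eq_some_iff.mp hw
    · simp only [wordε, h.wt_f i _ _ hy, h.ε_f i _ _ hy, coroot_sub, coroot_simpleRoot]; omega
    · simp only [wordε, ih _ hy]; omega

/-- The strict inequality in the rule for `f_i` matches the weak one for `e_i`: after `f_i` either
`φ_i` of the head has dropped by one or `ε_i` of the tail has grown by one, so both rules choose the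
same factor. -/
theorem IsCrystal.wordE_of_wordF (h : C.IsCrystal) (i : Fin (n - 1)) (w w' : List X)
    (hw : C.wordF i w = some w') : C.wordE i w' = some w := by
  induction w generalizing w' with
  | nil => simp [wordF] at hw
  | cons x l ih =>
    rw [wordF] at hw
    split_ifs at hw with hc <;> obtain ⟨y, hy, rfl⟩ := Option.map_eq_some_iff.mp hw
    · have := h.φ_f i _ _ hy
      rw [wordE, if_pos (by omega), (h.f_eq_iff i _ _).mp hy]; rfl
    · have := h.wordε_f i _ _ hy
      rw [wordE, if_neg (by omega), ih _ hy]; rfl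

theorem IsCrystal.wordF_of_wordE (h : C.IsCrystal) (i : Fin (n - 1)) (w w' : List X)
    (hw : C.wordE i w = some w') : C.wordF i w' = some w := by
  induction w generalizing w' with
  | nil => simp [wordE] at hw
  | cons x l ih =>
    rw [wordE] at hw
    split_ifs at hw with hc <;> obtain ⟨y, hy, rfl⟩ := Option.map_eq_some_iff.mp hw
    · have := h.φ_e i _ _ hy
      rw [wordF, if_pos (by omega), (h.f_eq_iff i _ _).mpr hy]; rfl
    · have := h.wordε_e i _ _ hy
      rw [wordF, if_neg (by omega), ih _ hy]; rfl

theorem IsCrystal.words (h : C.IsCrystal) : C.words.IsCrystal where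
  φ_sub_ε := h.wordφ_eq
  wt_e := h.wordWt_e
  wt_f := h.wordWt_f
  ε_e := h.wordε_e
  φ_e i w w' hw := by
    have h1 := h.wordφ_eq i w
    have h2 := h.wordφ_eq i w'
    rw [h.wordWt_e i w w' hw, h.wordε_e i w w' hw, coroot_add, coroot_simpleRoot] at h2
    change C.wordφ i w' = C.wordφ i w + 1
    omega
  ε_f := h.wordε_f
  φ_f i w w' hw := by
    have h1 := h.wordφ_eq i w
    have h2 := h.wordφ_eq i w'
    rw [h.wordWt_f i w w' hw, h.wordε_f i w w' hw, coroot_sub, coroot_simpleRoot] at h2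
    change C.wordφ i w' = C.wordφ i w - 1
    omega
  f_eq_iff i w w' := ⟨h.wordE_of_wordF i w w', h.wordF_of_wordE i w' w⟩

theorem IsSeminormal.wordε_nonneg (k : C.IsSeminormal) (i : Fin (n - 1)) (w : List X) :
    0 ≤ C.wordε i w := by
  cases w with
  | nil => simp [wordε]
  | cons x l => exact le_max_of_le_left (k.ε_nonneg i x)

theorem wordφ_nonneg (C : CrystalData n X) (i : Fin (n - 1)) (w : List X) :
    0 ≤ C.wordφ i w := by
  induction w with
  | nil => simp [wordφ]
  | cons x l ih => exact le_max_of_le_right ih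

/-- The factor on which the tensor product rule acts is one whose term attains the maximum in the
formula for `ε_i`, respectively `φ_i`. -/
theorem IsSeminormal.words (k : C.IsSeminormal) (h : C.IsCrystal) : C.words.IsSeminormal where
  ε_nonneg := k.wordε_nonneg
  φ_nonneg := C.wordφ_nonneg
  e_eq_none i w := by
    change C.wordE i w = none ↔ C.wordε i w = 0
    induction w with
    | nil => simp [wordE, wordε]
    | cons x l ih =>
      have := h.φ_sub_ε i x
      have := k.ε_nonneg i x
      have := k.φ_nonneg i x
      rw [wordE, wordε]
      split_ifs
      · rw [Option.map_eq_none_iff, k.e_eq_none]; omega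
      · rw [Option.map_eq_none_iff, ih]; omega
  f_eq_none i w := by
    change C.wordF i w = none ↔ C.wordφ i w = 0
    induction w with
    | nil => simp [wordF, wordφ]
    | cons x l ih =>
      have := h.φ_sub_ε i x
      have := k.φ_nonneg i x
      have := k.wordε_nonneg i l
      have := C.wordφ_nonneg i l
      have := h.wordφ_eq i l
      rw [wordF, wordφ]
      split_ifs
      · rw [Option.map_eq_none_iff, k.f_eq_none]; omega
      · rw [Option.map_eq_none_iff, ih]; omega

/-- The sign that a letter contributes for the index `i`, marked by the label of the letter. -/
def letterSign {τ : Type*} (C : CrystalData n X) (lab : X → τ) (i : Fin (n - 1)) (x : X) :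
    Option (Bool × τ) :=
  if C.φ i x = 1 then some (true, lab x) else if C.ε i x = 1 then some (false, lab x) else none

/-- The reduced sequence of signs of a word for the index `i`. -/
def wordSigns {τ : Type*} (C : CrystalData n X) (lab : X → τ) (i : Fin (n - 1)) (w : List X) :
    List (Bool × τ) :=
  reduce (w.filterMap (C.letterSign lab i))

/-! ### The signature rule -/

theorem consReduce_false {τ : Type*} (c : τ) (l : List (Bool × τ)) :
    consReduce (false, c) l = (false, c) :: l := by
  cases l <;> simp [consReduce]

theorem consReduce_true_map {τ : Type*} (c : τ) (q : List τ) :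
    consReduce (true, c) (q.map (Prod.mk true)) = (true, c) :: q.map (Prod.mk true) := by
  cases q <;> simp [consReduce]

variable {τ : Type*} {lab : X → τ}

theorem wordSigns_cons (i : Fin (n - 1)) (x : X) (w : List X) :
    C.wordSigns lab i (x :: w) =
      ((C.letterSign lab i x).elim id consReduce) (C.wordSigns lab i w) := by
  unfold wordSigns
  rw [List.filterMap_cons]
  cases C.letterSign lab i x <;> rfl

theorem letterSign_cases (k : C.IsSeminormal) (hm : C.IsMinuscule) (i : Fin (n - 1)) (x : X) :
    (C.φ i x = 1 ∧ C.ε i x = 0 ∧ C.letterSign lab i x = some (true, lab x)) ∨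
    (C.φ i x = 0 ∧ C.ε i x = 1 ∧ C.letterSign lab i x = some (false, lab x)) ∨
    (C.φ i x = 0 ∧ C.ε i x = 0 ∧ C.letterSign lab i x = none) := by
  have h1 := k.ε_nonneg i x
  have h2 := k.φ_nonneg i x
  have h3 := hm i x
  by_cases h4 : C.φ i x = 1
  · exact Or.inl ⟨h4, by omega, by simp [letterSign, h4]⟩
  · by_cases h5 : C.ε i x = 1
    · exact Or.inr (Or.inl ⟨by omega, h5, by simp [letterSign, h4, h5]⟩)
    · exact Or.inr (Or.inr ⟨by omega, by omega, by simp [letterSign, h4, h5]⟩)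

/-- The reduced sign sequence has `ε_i` signs `-` followed by `φ_i` signs `+`. -/
theorem wordSigns_eq (h : C.IsCrystal) (k : C.IsSeminormal) (hm : C.IsMinuscule)
    (i : Fin (n - 1)) (w : List X) :
    ∃ p q : List τ, C.wordSigns lab i w = p.map (Prod.mk false) ++ q.map (Prod.mk true) ∧
      (p.length : ℤ) = C.wordε i w ∧ (q.length : ℤ) = C.wordφ i w := by
  induction w with
  | nil => exact ⟨[], [], rfl, rfl, rfl⟩
  | cons x l ih =>
    obtain ⟨p, q, hr, hp, hq⟩ := ih
    have h1 := h.φ_sub_ε i x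
    have h2 := h.wordφ_eq i l
    rw [wordSigns_cons, hr]
    simp only [wordε, wordφ]
    rcases letterSign_cases (lab := lab) k hm i x with ⟨h3, h4, h5⟩ | ⟨h3, h4, h5⟩ | ⟨h3, h4, h5⟩ <;>
      rw [h5]
    -- A new `+` in front is kept if no `-` follows, and otherwise it cancels the first `-`.
    · cases p with
      | nil =>
        refine ⟨[], lab x :: q, ?_, ?_, ?_⟩
        · simpa using consReduce_true_map _ _
        all_goals
          simp only [List.length_cons, List.length_nil, Nat.cast_add, Nat.cast_zero, Nat.cast_one]
            at hp ⊢
          omega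
      | cons c p =>
        refine ⟨p, q, ?_, ?_, ?_⟩
        · simp [consReduce]
        all_goals simp only [List.length_cons, Nat.cast_add, Nat.cast_one] at hp ⊢; omega
    · refine ⟨lab x :: p, q, ?_, ?_, ?_⟩
      · simp [consReduce_false]
      · simp only [List.length_cons, Nat.cast_add, Nat.cast_one]; omega
      · omega
    · have := k.wordε_nonneg i l
      have := C.wordφ_nonneg i l
      refine ⟨p, q, rfl, ?_, ?_⟩ <;> omega

/-- `f_i` changes the letter of the leftmost sign `+` of the reduced sequence, which becomes `-`. -/
theorem wordF_eq_some (h : C.IsCrystal) (k : C.IsSeminormal) (hm : C.IsMinuscule)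
    {i : Fin (n - 1)} (hlab : ∀ x x', C.f i x = some x' → lab x' = lab x) {w w' : List X}
    (hw : C.wordF i w = some w') :
    ∃ (u : List X) (x x' : X) (v : List X) (p q : List τ),
      w = u ++ x :: v ∧ w' = u ++ x' :: v ∧ C.f i x = some x' ∧
      C.wordε i v = 0 ∧ (∀ y ∈ u.getLast?, C.φ i y = 0) ∧
      (p.length : ℤ) = C.wordε i w ∧
      C.wordSigns lab i w = p.map (Prod.mk false) ++ (lab x :: q).map (Prod.mk true) ∧
      C.wordSigns lab i w' = (p ++ [lab x]).map (Prod.mk false) ++ q.map (Prod.mk true) := by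
  induction w generalizing w' with
  | nil => simp [wordF] at hw
  | cons x l ih =>
    have hx := letterSign_cases (lab := lab) k hm i x
    have h1 := h.φ_sub_ε i x
    rw [wordF] at hw
    split_ifs at hw with hc <;> obtain ⟨y, hy, rfl⟩ := Option.map_eq_some_iff.mp hw
    · have h2 := k.wordε_nonneg i l
      obtain ⟨h3, h4, h5⟩ := hx.resolve_right (by omega)
      have h6 := h.ε_f i _ _ hy
      obtain ⟨h7, h8, h9⟩ :=
        (letterSign_cases (lab := lab) k hm i y).resolve_left (by omega) |>.resolve_right (by omega)
      obtain ⟨p, q, hr, hp, hq⟩ := wordSigns_eq (lab := lab) h k hm i l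
      -- Here `ε_i(l) < φ_i(x) = 1`, so no sign `-` remains in the tail to cancel the `+` of `x`.
      obtain rfl : p = [] := List.eq_nil_of_length_eq_zero (by omega)
      refine ⟨[], x, y, l, [], q, rfl, rfl, hy, by omega, by simp, ?_, ?_, ?_⟩
      · simp only [wordε, List.length_nil, Nat.cast_zero]; omega
      · rw [wordSigns_cons, h5, hr]
        simpa using consReduce_true_map _ _
      · rw [wordSigns_cons, h9, hr, hlab _ _ hy]
        simp [consReduce_false]
    · obtain ⟨u, z, z', v, p, q, rfl, rfl, hz, hv, hu, hp, hr, hr'⟩ := ih hy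
      -- A letter in front of the tail affects only the signs `-`: the list `p` loses its head,
      -- gains one, or stays. The signs from the changed one onwards are untouched.
      suffices key : ∃ p' : List τ,
          (p'.length : ℤ) = max (C.ε i x) (C.wordε i (u ++ z :: v) - coroot i (C.wt x)) ∧
          C.wordSigns lab i (x :: (u ++ z :: v)) =
            p'.map (Prod.mk false) ++ (lab z :: q).map (Prod.mk true) ∧
          C.wordSigns lab i (x :: (u ++ z' :: v)) =
            (p' ++ [lab z]).map (Prod.mk false) ++ q.map (Prod.mk true) by
        obtain ⟨p', e1, e2, e3⟩ := key
        refine ⟨x :: u, z, z', v, p', q, rfl, rfl, hz, hv, ?_, e1, e2, e3⟩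
        cases u with
        | nil =>
          -- Now `x` is the left neighbour of `z`. If `φ_i(x) = 1`, then passing over `x` would need
          -- `1 ≤ ε_i(z ⊗ v)`, but `z` carries `+` and `ε_i(v) = 0`.
          have h2 := letterSign_cases (lab := lab) k hm i z
          have h3 := (k.f_eq_none i z).not.mp (by simp [hz])
          have h4 := k.φ_nonneg i x
          have h5 := h.φ_sub_ε i z
          simp only [List.nil_append, wordε] at hc
          simp only [List.getLast?_singleton, Option.mem_some_iff, forall_eq']
          omega
        | cons y u => simpa [List.getLast?_cons_cons] using hu
      rcases hx with ⟨h3, h4, h5⟩ | ⟨h3, h4, h5⟩ | ⟨h3, h4, h5⟩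
      · cases p with
        -- The rule passes over a letter with `+` only if the tail has a `-` left, so `p` is
        -- nonempty.
        | nil => simp at hp; omega
        | cons c p =>
          refine ⟨p, ?_, ?_, ?_⟩
          · simp at hp; omega
          · rw [wordSigns_cons, hr, h5]; simp [consReduce]
          · rw [wordSigns_cons, hr', h5]; simp [consReduce]
      · refine ⟨lab x :: p, ?_, ?_, ?_⟩
        · simp at hp ⊢; omega
        · rw [wordSigns_cons, hr, h5]; simp [consReduce_false]
        · rw [wordSigns_cons, hr', h5]; simp [consReduce_false]
      · refine ⟨p, ?_, ?_, ?_⟩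
        · have := k.wordε_nonneg i (u ++ z :: v)
          omega
        · rw [wordSigns_cons, hr, h5]; rfl
        · rw [wordSigns_cons, hr', h5]; rfl

end words

/-! ### Regularity -/

/-- Each application lowers `ε_i` by one, and `e_i` vanishes exactly when `ε_i` has reached `0`. -/
theorem IsSeminormal.e_string {C : CrystalData n X} (k : C.IsSeminormal) (h : C.IsCrystal)
    (i : Fin (n - 1)) (m : ℕ) (b : X) : iter (C.e i) m b ≠ none ↔ (m : ℤ) ≤ C.ε i b := by
  induction m generalizing b with
  | zero => simpa [iter] using k.ε_nonneg i b
  | succ m ih =>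
    rw [iter]
    cases hb : C.e i b with
    | none =>
      have := (k.e_eq_none i b).mp hb
      simp only [Option.bind_none, ne_eq, not_true_eq_false, false_iff]
      push_cast; omega
    | some b' =>
      rw [Option.bind_some, ih, h.ε_e i _ _ hb]
      push_cast; omega

theorem IsSeminormal.f_string {C : CrystalData n X} (k : C.IsSeminormal) (h : C.IsCrystal)
    (i : Fin (n - 1)) (m : ℕ) (b : X) : iter (C.f i) m b ≠ none ↔ (m : ℤ) ≤ C.φ i b :=
  k.dual.e_string h.dual i m b

theorem isRegular_of {C : CrystalData n X} (h : C.IsCrystal) (k : C.IsSeminormal)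
    (hc : ∀ b, ∃ w : List (Fin n ⊕ Fin n),
      C.Equivalent ((nat n).union (nat n).dual).words b w) : C.IsRegular where
  isCrystal := h
  ε_eq i b := by
    obtain ⟨m, hm⟩ := Int.eq_ofNat_of_zero_le (k.ε_nonneg i b)
    refine ⟨m, hm, (k.e_string h i m b).mpr hm.ge, fun j hj => ?_⟩
    have := (k.e_string h i j b).mp hj
    omega
  φ_eq i b := by
    obtain ⟨m, hm⟩ := Int.eq_ofNat_of_zero_le (k.φ_nonneg i b)
    refine ⟨m, hm, (k.f_string h i m b).mpr hm.ge, fun j hj => ?_⟩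
    have := (k.f_string h i j b).mp hj
    omega
  component := hc

/-- A map of crystals that commutes with all of the structure. -/
structure IsStrictMorphism (D : CrystalData n Y) (C : CrystalData n X) (g : Y → X) : Prop where
  wt_eq : ∀ y, C.wt (g y) = D.wt y
  ε_eq : ∀ i y, C.ε i (g y) = D.ε i y
  φ_eq : ∀ i y, C.φ i (g y) = D.φ i y
  e_eq : ∀ i y, C.e i (g y) = (D.e i y).map g
  f_eq : ∀ i y, C.f i (g y) = (D.f i y).map g

theorem IsStrictEmbedding.toMorphism {D : CrystalData n Y} {C : CrystalData n X} {g : Y → X}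
    (h : D.IsStrictEmbedding C g) : D.IsStrictMorphism C g :=
  ⟨h.wt_eq, h.ε_eq, h.φ_eq, h.e_eq, h.f_eq⟩

theorem IsStrictMorphism.comp {D : CrystalData n Y} {C : CrystalData n X} {E : CrystalData n Z}
    {g : Y → X} {g' : X → Z} (h' : C.IsStrictMorphism E g') (h : D.IsStrictMorphism C g) :
    D.IsStrictMorphism E (g' ∘ g) where
  wt_eq y := (h'.wt_eq _).trans (h.wt_eq y)
  ε_eq i y := (h'.ε_eq i _).trans (h.ε_eq i y)
  φ_eq i y := (h'.φ_eq i _).trans (h.φ_eq i y)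
  e_eq i y := by rw [Function.comp_apply, h'.e_eq, h.e_eq, Option.map_map]
  f_eq i y := by rw [Function.comp_apply, h'.f_eq, h.f_eq, Option.map_map]

theorem IsStrictMorphism.connected {D : CrystalData n Y} {C : CrystalData n X} {g : Y → X}
    (h : D.IsStrictMorphism C g) {b c : Y} (hbc : D.Connected b c) : C.Connected (g b) (g c) := by
  induction hbc with
  | rel x y hxy =>
    obtain ⟨i, hi⟩ := hxy
    refine Relation.EqvGen.rel _ _ ⟨i, hi.imp (fun hf => ?_) (fun he => ?_)⟩
    · rw [h.f_eq, hf]; rfl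
    · rw [h.e_eq, he]; rfl
  | refl x => exact Relation.EqvGen.refl _
  | symm x y _ ih => exact Relation.EqvGen.symm _ _ ih
  | trans x y z _ _ ih1 ih2 => exact Relation.EqvGen.trans _ _ _ ih1 ih2

/-- Strictness lifts any arrow out of `g b` to an arrow out of `b`, so paths lift step by step.
Lifting from both ends is asserted together because connectedness is a generated equivalence and the
induction must pass through its symmetry case. -/
theorem IsStrictMorphism.exists_connected {D : CrystalData n Y} {C : CrystalData n X} {g : Y → X}
    (h : D.IsStrictMorphism C g) (hC : C.IsCrystal) {x x' : X}
    (hx : C.Connected x x') :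
    (∀ b, g b = x → ∃ b', D.Connected b b' ∧ g b' = x') ∧
      (∀ b, g b = x' → ∃ b', D.Connected b b' ∧ g b' = x) := by
  have step : ∀ {x x' : X}, (∃ i, C.f i x = some x' ∨ C.e i x = some x') →
      ∀ b, g b = x → ∃ b', D.Connected b b' ∧ g b' = x' := by
    rintro x x' ⟨i, hi⟩ b rfl
    rcases hi with hi | hi
    · rw [h.f_eq] at hi
      obtain ⟨b', hb, rfl⟩ := Option.map_eq_some_iff.mp hi
      exact ⟨b', Relation.EqvGen.rel _ _ ⟨i, Or.inl hb⟩, rfl⟩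
    · rw [h.e_eq] at hi
      obtain ⟨b', hb, rfl⟩ := Option.map_eq_some_iff.mp hi
      exact ⟨b', Relation.EqvGen.rel _ _ ⟨i, Or.inr hb⟩, rfl⟩
  induction hx with
  | rel x y hxy =>
    refine ⟨step hxy, step ?_⟩
    obtain ⟨i, hi⟩ := hxy
    exact ⟨i, hi.symm.imp (hC.f_eq_iff i y x).mpr (hC.f_eq_iff i x y).mp⟩
  | refl x => exact ⟨fun b hb => ⟨b, Relation.EqvGen.refl _, hb⟩,
      fun b hb => ⟨b, Relation.EqvGen.refl _, hb⟩⟩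
  | symm x y _ ih => exact ih.symm
  | trans x y z _ _ ih1 ih2 =>
    constructor
    · intro b hb
      obtain ⟨b', h1, h2⟩ := ih1.1 b hb
      obtain ⟨b'', h3, h4⟩ := ih2.1 b' h2
      exact ⟨b'', Relation.EqvGen.trans _ _ _ h1 h3, h4⟩
    · intro b hb
      obtain ⟨b', h1, h2⟩ := ih2.2 b hb
      obtain ⟨b'', h3, h4⟩ := ih1.2 b' h2
      exact ⟨b'', Relation.EqvGen.trans _ _ _ h1 h3, h4⟩

/-- A strict morphism that is injective on connected components preserves the component. -/
theorem IsStrictMorphism.equivalent {D : CrystalData n Y} {C : CrystalData n X} {g : Y → X}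
    (h : D.IsStrictMorphism C g) (hC : C.IsCrystal)
    (hinj : ∀ x y, D.Connected x y → g x = g y → x = y) (b : Y) : D.Equivalent C b (g b) := by
  have hinj' : ∀ x y : {x // D.Connected b x}, g x = g y → x = y := fun x y hxy =>
    Subtype.ext (hinj _ _ (Relation.EqvGen.trans _ _ _ (Relation.EqvGen.symm _ _ x.2) y.2) hxy)
  refine ⟨Equiv.ofBijective
    (fun x : {x // D.Connected b x} => (⟨g x.1, h.connected x.2⟩ : {y // C.Connected (g b) y}))
    ⟨fun x y hxy => hinj' x y (congrArg Subtype.val hxy), fun y => ?_⟩, rfl,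
    fun x => h.wt_eq _, fun i x => ⟨h.ε_eq i _, h.φ_eq i _⟩, fun i x x' => ?_, fun i x x' => ?_⟩
  · obtain ⟨b', h1, h2⟩ := (h.exists_connected hC y.2).1 b rfl
    exact ⟨⟨b', h1⟩, Subtype.ext h2⟩
  · change _ ↔ C.e i (g x.1) = some (g x'.1)
    rw [h.e_eq, Option.map_eq_some_iff]
    refine ⟨fun hx => ⟨_, hx, rfl⟩, fun ⟨y, hy, hyx⟩ => ?_⟩
    -- Injectivity is available only within the component of `b`, so the preimage `y` has to be
    -- placed there first.
    have hby : D.Connected b y :=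
      Relation.EqvGen.trans _ _ _ x.2 (Relation.EqvGen.rel _ _ ⟨i, Or.inr hy⟩)
    rw [hy, ← hinj' ⟨y, hby⟩ x' hyx]
  · change _ ↔ C.f i (g x.1) = some (g x'.1)
    rw [h.f_eq, Option.map_eq_some_iff]
    refine ⟨fun hx => ⟨_, hx, rfl⟩, fun ⟨y, hy, hyx⟩ => ?_⟩
    have hby : D.Connected b y :=
      Relation.EqvGen.trans _ _ _ x.2 (Relation.EqvGen.rel _ _ ⟨i, Or.inl hy⟩)
    rw [hy, ← hinj' ⟨y, hby⟩ x' hyx]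

theorem IsStrictEmbedding.isCrystal {D : CrystalData n Y} {C : CrystalData n X} {g : Y → X}
    (h : D.IsStrictEmbedding C g) (hC : C.IsCrystal) : D.IsCrystal := by
  have he : ∀ i b b', D.e i b = some b' ↔ C.e i (g b) = some (g b') := fun i b b' => by
    rw [h.e_eq]
    exact ((Option.map_injective h.injective).eq_iff (b := some b')).symm
  have hf : ∀ i b b', D.f i b = some b' ↔ C.f i (g b) = some (g b') := fun i b b' => by
    rw [h.f_eq]
    exact ((Option.map_injective h.injective).eq_iff (b := some b')).symm
  constructor <;> simp only [he, hf, ← h.wt_eq, ← h.ε_eq, ← h.φ_eq]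
  · exact fun i b => hC.φ_sub_ε i _
  · exact fun i b b' => hC.wt_e i _ _
  · exact fun i b b' => hC.wt_f i _ _
  · exact fun i b b' => hC.ε_e i _ _
  · exact fun i b b' => hC.φ_e i _ _
  · exact fun i b b' => hC.ε_f i _ _
  · exact fun i b b' => hC.φ_f i _ _
  · exact fun i b b' => hC.f_eq_iff i _ _

theorem IsStrictMorphism.isSeminormal {D : CrystalData n Y} {C : CrystalData n X} {g : Y → X}
    (h : D.IsStrictMorphism C g) (hC : C.IsSeminormal) : D.IsSeminormal where
  ε_nonneg i b := h.ε_eq i b ▸ hC.ε_nonneg i _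
  φ_nonneg i b := h.φ_eq i b ▸ hC.φ_nonneg i _
  e_eq_none i b := by rw [← h.ε_eq, ← hC.e_eq_none, h.e_eq, Option.map_eq_none_iff]
  f_eq_none i b := by rw [← h.φ_eq, ← hC.f_eq_none, h.f_eq, Option.map_eq_none_iff]

/-- Stability of the image ensures that the pullback has value `none` only where the operator of `C`
itself vanishes. -/
theorem pullback_isStrictEmbedding (C : CrystalData n X) {g : Y → X} (hg : Function.Injective g)
    (he : ∀ i y w, C.e i (g y) = some w → ∃ y', w = g y')
    (hf : ∀ i y w, C.f i (g y) = some w → ∃ y', w = g y') :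
    (C.pullback g).IsStrictEmbedding C g where
  injective := hg
  wt_eq _ := rfl
  ε_eq _ _ := rfl
  φ_eq _ _ := rfl
  e_eq i y := by
    simp only [pullback]
    split_ifs with h
    · exact h.choose_spec
    · cases hy : C.e i (g y) with
      | none => rfl
      | some w =>
        obtain ⟨y', rfl⟩ := he i y w hy
        exact absurd ⟨y', hy⟩ h
  f_eq i y := by
    simp only [pullback]
    split_ifs with h
    · exact h.choose_spec
    · cases hy : C.f i (g y) with
      | none => rfl
      | some w =>
        obtain ⟨y', rfl⟩ := hf i y w hy
        exact absurd ⟨y', hy⟩ h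

/-- A strict morphism of letters induces one of words. -/
theorem IsStrictMorphism.words {D : CrystalData n Y} {C : CrystalData n X} {g : Y → X}
    (h : D.IsStrictMorphism C g) : D.words.IsStrictMorphism C.words (List.map g) := by
  have hwt : ∀ w, C.wordWt (w.map g) = D.wordWt w := fun w => by
    induction w with
    | nil => rfl
    | cons x l ih => simp only [List.map_cons, wordWt, ih, h.wt_eq]
  have hε : ∀ i w, C.wordε i (w.map g) = D.wordε i w := fun i w => by
    induction w with
    | nil => rfl
    | cons x l ih => simp only [List.map_cons, wordε, ih, h.wt_eq, h.ε_eq]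
  refine ⟨hwt, hε, fun i w => ?_, fun i w => ?_, fun i w => ?_⟩
  · change C.wordφ i _ = D.wordφ i _
    induction w with
    | nil => rfl
    | cons x l ih => simp only [List.map_cons, wordφ, ih, hwt, h.φ_eq]
  · change C.wordE i _ = (D.wordE i _).map _
    induction w with
    | nil => rfl
    | cons x l ih =>
      simp only [List.map_cons, wordE, ih, hε, h.φ_eq, h.e_eq]
      split_ifs <;> simp [Option.map_map, Function.comp_def]
  · change C.wordF i _ = (D.wordF i _).map _
    induction w with
    | nil => rfl
    | cons x l ih =>
      simp only [List.map_cons, wordF, ih, hε, h.φ_eq, h.f_eq]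
      split_ifs <;> simp [Option.map_map, Function.comp_def]

end CrystalData

end FockCrystal

/-! ### Counting in lists -/

section lists

/-- Blocks with different labels are disjoint and no label repeats, so only the block of the label
of `x` can contain `x`. The hypothesis `hx` covers a label that is missing from `L`. -/
theorem List.count_flatMap_of_label {κ α : Type*} [BEq α] [LawfulBEq α] (lab : α → κ)
    (f : κ → List α) (hf : ∀ c, ∀ x ∈ f c, lab x = c) {L : List κ} (hL : L.Nodup) (x : α)
    (hx : lab x ∉ L → x ∉ f (lab x)) : (L.flatMap f).count x = (f (lab x)).count x := by
  have key : ∀ M : List κ, lab x ∉ M → (M.flatMap f).count x = 0 := fun M hM =>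
    List.count_eq_zero_of_not_mem fun h => by
      obtain ⟨c, hc, hxc⟩ := List.mem_flatMap.mp h
      exact hM (hf c x hxc ▸ hc)
  by_cases hm : lab x ∈ L
  · obtain ⟨M, N, rfl⟩ := List.append_of_mem hm
    have hM : lab x ∉ M := fun h => (List.nodup_append.mp hL).2.2 _ h _ List.mem_cons_self rfl
    have hN : lab x ∉ N := (List.nodup_cons.mp (List.nodup_append.mp hL).2.1).1
    rw [List.flatMap_append, List.flatMap_cons, List.count_append, List.count_append, key M hM,
      key N hN, zero_add, add_zero]
  · rw [key L hm, List.count_eq_zero_of_not_mem (hx hm)]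

theorem List.count_filterMap_of_iff {α β : Type*} [BEq α] [LawfulBEq α] [BEq β] [LawfulBEq β]
    (g : α → Option β) (x : α) (y : β) (h : ∀ z, g z = some y ↔ z = x) (l : List α) :
    (l.filterMap g).count y = l.count x := by
  induction l with
  | nil => rfl
  | cons z l ih =>
    rw [List.filterMap_cons, List.count_cons]
    cases hz : g z with
    | none =>
      have : z ≠ x := fun e => by simp [(h z).mpr e] at hz
      simp [ih, this]
    | some y' =>
      simp only [List.count_cons, ih]
      by_cases e : z = x
      · have := (h z).mpr e
        rw [hz] at this
        cases this
        simp [e]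
      · have : y' ≠ y := fun e' => e ((h z).mp (e' ▸ hz))
        simp [e, this]

theorem List.Pairwise.count_le_one {α : Type*} [BEq α] [LawfulBEq α] {R : α → α → Prop} {l : List α}
    (h : l.Pairwise R) {x : α} (hx : ¬R x x) : l.count x ≤ 1 := by
  by_contra hc
  have h1 : (List.replicate 2 x).Sublist l := List.replicate_sublist_iff.mpr (by omega)
  exact (List.pairwise_replicate.mp (h.sublist h1)).elim (by omega) hx

end lists

namespace FockCrystal

open CrystalData

/-! ### Letters -/

/-- Letters of the words that represent the elements of `𝓕ⁿ`. -/
abbrev Letter (A B : Type*) (n : ℕ) : Type _ := (A × Fin n) ⊕ (B × Fin n)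

/-- The crystal of letters. -/
abbrev letters (A B : Type*) (n : ℕ) : CrystalData n (Letter A B n) :=
  ((CrystalData.nat n).copies A).union ((CrystalData.nat n).dual.copies B)

namespace Letter

variable {A B : Type*} {n : ℕ}

/-- The label of a letter. -/
def label : Letter A B n → A ⊕ B := Sum.map Prod.fst Prod.fst

/-- The index of a letter, without its sign. -/
def pos : Letter A B n → Fin n := Sum.elim Prod.snd Prod.snd

/-- The letter without its label. -/
def forget : Letter A B n → Fin n ⊕ Fin n := Sum.map Prod.snd Prod.snd

/-- The letter with a given label and a given index. -/
def mk (c : A ⊕ B) (j : Fin n) : Letter A B n := c.map (·, j) (·, j)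

theorem eq_mk (x : Letter A B n) : x = mk x.label x.pos := by rcases x with x | x <;> rfl

@[simp] theorem label_mk (c : A ⊕ B) (j : Fin n) : (mk c j).label = c := by
  rcases c with a | b <;> rfl

@[simp] theorem pos_mk (c : A ⊕ B) (j : Fin n) : (mk c j).pos = j := by
  rcases c with a | b <;> rfl

theorem mk_inj {c d : A ⊕ B} {j k : Fin n} : mk c j = mk d k ↔ c = d ∧ j = k := by
  refine ⟨fun h => ⟨?_, ?_⟩, fun h => by rw [h.1, h.2]⟩
  · simpa using congrArg label h
  · simpa using congrArg pos h

theorem isCrystal : (letters A B n).IsCrystal :=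
  ((nat_isCrystal n).copies A).union ((nat_isCrystal n).dual.copies B)

theorem isSeminormal : (letters A B n).IsSeminormal :=
  ((nat_isSeminormal n).copies A).union ((nat_isSeminormal n).dual.copies B)

theorem isMinuscule : (letters A B n).IsMinuscule :=
  ((nat_isMinuscule n).copies A).union ((nat_isMinuscule n).dual.copies B)

theorem forget_isStrictMorphism :
    (letters A B n).IsStrictMorphism ((nat n).union (nat n).dual) forget where
  wt_eq x := by rcases x with x | x <;> rfl
  ε_eq i x := by rcases x with x | x <;> rfl
  φ_eq i x := by rcases x with x | x <;> rfl
  e_eq i x := by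
    rcases x with x | x <;>
      simp [letters, CrystalData.union, CrystalData.copies, forget, Option.map_map,
        Function.comp_def]
  f_eq i x := by
    rcases x with x | x <;>
      simp [letters, CrystalData.union, CrystalData.copies, forget, Option.map_map,
        Function.comp_def]

/-- The index at which `c` contributes a sign `+` (for `true`) or `-` (for `false`). -/
def signPos (i : Fin (n - 1)) (s : Bool) (c : A ⊕ B) : Fin n :=
  Sum.elim (fun _ => if s then lo i else hi i) (fun _ => if s then hi i else lo i) c

theorem φ_eq_one_iff (i : Fin (n - 1)) (x : Letter A B n) :
    (letters A B n).φ i x = 1 ↔ x.pos = signPos i true x.label := by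
  rcases x with ⟨a, j⟩ | ⟨b, j⟩ <;>
    simp [letters, CrystalData.union, CrystalData.copies, CrystalData.nat, CrystalData.dual,
      signPos, pos, label]

theorem ε_eq_one_iff (i : Fin (n - 1)) (x : Letter A B n) :
    (letters A B n).ε i x = 1 ↔ x.pos = signPos i false x.label := by
  rcases x with ⟨a, j⟩ | ⟨b, j⟩ <;>
    simp [letters, CrystalData.union, CrystalData.copies, CrystalData.nat, CrystalData.dual,
      signPos, pos, label]

theorem f_eq_some_iff (i : Fin (n - 1)) (x x' : Letter A B n) :
    (letters A B n).f i x = some x' ↔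
      ∃ c, x = mk c (signPos i true c) ∧ x' = mk c (signPos i false c) := by
  rcases x with ⟨a, j⟩ | ⟨b, j⟩ <;> rcases x' with ⟨a', j'⟩ | ⟨b', j'⟩ <;>
    simp [letters, CrystalData.union, CrystalData.copies, CrystalData.nat, CrystalData.dual,
      signPos, mk] <;> grind

theorem φ_eq_zero_iff (i : Fin (n - 1)) (x : Letter A B n) :
    (letters A B n).φ i x = 0 ↔ x.pos ≠ signPos i true x.label := by
  have := isSeminormal.φ_nonneg i x
  have := isSeminormal.ε_nonneg i x
  have := isMinuscule i x
  rw [ne_eq, ← φ_eq_one_iff]; omega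

theorem ε_eq_zero_iff (i : Fin (n - 1)) (x : Letter A B n) :
    (letters A B n).ε i x = 0 ↔ x.pos ≠ signPos i false x.label := by
  have := isSeminormal.φ_nonneg i x
  have := isSeminormal.ε_nonneg i x
  have := isMinuscule i x
  rw [ne_eq, ← ε_eq_one_iff]; omega

theorem letterSign_eq_some_iff (i : Fin (n - 1)) (x : Letter A B n) (s : Bool) (c : A ⊕ B) :
    (letters A B n).letterSign label i x = some (s, c) ↔ x = mk c (signPos i s c) := by
  have h1 : signPos i true x.label ≠ signPos i false x.label := by
    rcases x with x | x
    exacts [lo_ne_hi i, (lo_ne_hi i).symm]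
  simp only [letterSign, φ_eq_one_iff, ε_eq_one_iff]
  have h2 : x = mk c (signPos i s c) ↔ x.label = c ∧ x.pos = signPos i s c := by
    nth_rewrite 1 [eq_mk x]; exact mk_inj
  rw [h2]
  cases s <;> split_ifs with h3 h4 <;> simp <;> grind

theorem label_f (i : Fin (n - 1)) (x x' : Letter A B n) (h : (letters A B n).f i x = some x') :
    x'.label = x.label := by
  obtain ⟨c, rfl, rfl⟩ := (f_eq_some_iff i x x').mp h
  simp

/-! ### The order on letters -/

variable [LinearOrder A] [LinearOrder B] (pA : A → ZMod 2) (pB : B → ZMod 2)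

/-- The order in which the letters of a word of an element of `𝓕ⁿ` appear. -/
def Rel : Letter A B n → Letter A B n → Prop
  | .inl (a, j), .inl (a', j') => a' < a ∨ (a = a' ∧ if pA a = 0 then j' ≤ j else j < j')
  | .inl _, .inr _ => True
  | .inr _, .inl _ => False
  | .inr (b, j), .inr (b', j') => b < b' ∨ (b = b' ∧ if pB b = 0 then j ≤ j' else j' < j)

variable {pA pB}

/-- Transitivity makes sortedness a condition on adjacent letters only, which is what
`pairwise_f_iff` relies on. -/
instance : Trans (Rel (n := n) pA pB) (Rel pA pB) (Rel pA pB) where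
  trans {x y z} h1 h2 := by
    rcases x with ⟨a, j⟩ | ⟨b, j⟩ <;> rcases y with ⟨a', j'⟩ | ⟨b', j'⟩ <;>
      rcases z with ⟨a'', j''⟩ | ⟨b'', j''⟩ <;> simp only [Rel] at h1 h2 ⊢ <;> grind

theorem Rel.antisymm {x y : Letter A B n} (h1 : Rel pA pB x y) (h2 : Rel pA pB y x) : x = y := by
  rcases x with ⟨a, j⟩ | ⟨b, j⟩ <;> rcases y with ⟨a', j'⟩ | ⟨b', j'⟩ <;>
    simp only [Rel] at h1 h2 ⊢ <;> grind

theorem rel_of_lex {x y : Letter A B n} (h : Sum.Lex (· > ·) (· < ·) x.label y.label) :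
    Rel pA pB x y := by
  rcases x with ⟨a, j⟩ | ⟨b, j⟩ <;> rcases y with ⟨a', j'⟩ | ⟨b', j'⟩ <;>
    simp [Rel, label] at h ⊢
  · exact Or.inl h
  · exact Or.inl h

/-- The indices of the two letters are the neighbours `i` and `i + 1`, so a comparison with an
equally labelled `y` can differ only if `y` sits at one of them. For `y` on the left this is the
index at which `y` would carry the sign `+`, which the hypothesis excludes, for either parity. -/
theorem rel_left_iff (i : Fin (n - 1)) (c : A ⊕ B) {y : Letter A B n}
    (hy : (letters A B n).φ i y = 0) :
    Rel pA pB y (mk c (signPos i true c)) ↔ Rel pA pB y (mk c (signPos i false c)) := by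
  rw [φ_eq_zero_iff] at hy
  rcases c with a | b <;> rcases y with ⟨a', j⟩ | ⟨b', j⟩ <;>
    simp only [Rel, mk, Sum.map_inl, Sum.map_inr, signPos, Sum.elim_inl, Sum.elim_inr, pos, label,
      if_true, Bool.false_eq_true, if_false, Fin.le_def, Fin.lt_def, ne_eq, Fin.ext_iff, lo, hi]
      at hy ⊢
  · refine or_congr_right (and_congr_right fun h => ?_)
    split_ifs <;> omega
  · refine or_congr_right (and_congr_right fun h => ?_)
    split_ifs <;> omega

/-- As for `rel_left_iff`; on the right the only critical index is the one at which `z` would carry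
the sign `-`. -/
theorem rel_right_iff (i : Fin (n - 1)) (c : A ⊕ B) {z : Letter A B n}
    (hz : (letters A B n).ε i z = 0) :
    Rel pA pB (mk c (signPos i true c)) z ↔ Rel pA pB (mk c (signPos i false c)) z := by
  rw [ε_eq_zero_iff] at hz
  rcases c with a | b <;> rcases z with ⟨a', j⟩ | ⟨b', j⟩ <;>
    simp only [Rel, mk, Sum.map_inl, Sum.map_inr, signPos, Sum.elim_inl, Sum.elim_inr, pos, label,
      if_true, Bool.false_eq_true, if_false, Fin.le_def, Fin.lt_def, ne_eq, Fin.ext_iff, lo, hi]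
      at hz ⊢
  · refine or_congr_right (and_congr_right fun h => ?_)
    split_ifs <;> omega
  · refine or_congr_right (and_congr_right fun h => ?_)
    split_ifs <;> omega

/-- The operators `f_i` preserve, in both directions, the words whose letters are in order. -/
theorem pairwise_f_iff {i : Fin (n - 1)} {w w' : List (Letter A B n)}
    (h : (letters A B n).wordF i w = some w') :
    w.Pairwise (Rel pA pB) ↔ w'.Pairwise (Rel pA pB) := by
  obtain ⟨u, x, x', v, p, q, rfl, rfl, hx, hv, hu, -⟩ :=
    wordF_eq_some (lab := label) isCrystal isSeminormal isMinuscule (label_f i) h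
  obtain ⟨c, rfl, rfl⟩ := (f_eq_some_iff i _ _).mp hx
  have hv' : ∀ z ∈ v.head?, (letters A B n).ε i z = 0 := by
    cases v with
    | nil => simp
    | cons z v =>
      have := isSeminormal.ε_nonneg i z
      simp only [wordε] at hv
      simp only [List.head?_cons, Option.mem_some_iff, forall_eq']
      omega
  -- As a chain condition, sortedness involves the changed letter only through its two neighbours.
  simp only [← List.isChain_iff_pairwise, List.isChain_append, List.isChain_cons, List.head?_cons,
    Option.mem_some_iff, forall_eq']
  have h1 : (∀ y ∈ u.getLast?, Rel pA pB y (mk c (signPos i true c))) ↔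
      ∀ y ∈ u.getLast?, Rel pA pB y (mk c (signPos i false c)) :=
    forall₂_congr fun y hy => rel_left_iff i c (hu y hy)
  have h2 : (∀ z ∈ v.head?, Rel pA pB (mk c (signPos i true c)) z) ↔
      ∀ z ∈ v.head?, Rel pA pB (mk c (signPos i false c)) z :=
    forall₂_congr fun z hz => rel_right_iff i c (hv' z hz)
  rw [h1, h2]

end Letter

end FockCrystal

namespace FockCrystal

open CrystalData

variable {A B : Type*} [LinearOrder A] [LinearOrder B] {pA : A → ZMod 2} {pB : B → ZMod 2} {n : ℕ}

/-! ### Tableaux and multiplicities -/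

namespace Row

variable {p : A → ZMod 2}

theorem ext_count {R S : Row p} (h : ∀ a, R.entries.count a = S.entries.count a) : R = S := by
  obtain ⟨l, hl⟩ := R
  obtain ⟨m, hm⟩ := S
  have hle : ∀ {l : List A}, l.Pairwise (fun x y => x < y ∨ (x = y ∧ p x = 0)) →
      l.Pairwise (· ≤ ·) := fun h => h.imp fun h => h.elim le_of_lt fun h => h.1.le
  have : l = m := (List.perm_iff_count.mpr h).eq_of_pairwise
    (fun a b _ _ => le_antisymm) (hle hl) (hle hm)
  subst this
  rfl

theorem count_ofMultiset (s : Multiset A) (h : ∀ a, p a ≠ 0 → s.count a ≤ 1) (a : A) :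
    (ofMultiset s h).entries.count a = s.count a := by
  rw [← Multiset.coe_count]
  exact congrArg (Multiset.count a) (Multiset.sort_eq s (· ≤ ·))

theorem count_remove (R : Row p) (Y : Multiset A) (a : A) :
    (R.remove Y).entries.count a = R.entries.count a - Y.count a := by
  rw [remove, count_ofMultiset, Multiset.count_sub, Multiset.coe_count]

theorem count_insert (R : Row p) (Y : Multiset A)
    (h : ∀ a, p a ≠ 0 → R.entries.count a + Y.count a ≤ 1) (a : A) :
    (R.insert Y h).entries.count a = R.entries.count a + Y.count a := by
  rw [insert, count_ofMultiset, Multiset.count_add, Multiset.coe_count]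

end Row

theorem rowOrder_pairwise (sA : Finset A) (sB : Finset B) :
    (rowOrder sA sB).Pairwise (Sum.Lex (· > ·) (· < ·)) := by
  rw [rowOrder, List.pairwise_append]
  refine ⟨List.pairwise_map.mpr ?_, List.pairwise_map.mpr ?_, ?_⟩
  · exact (sA.sortedGT_sort.pairwise).imp Sum.Lex.inl
  · exact (sB.sortedLT_sort.pairwise).imp Sum.Lex.inr
  · intro x hx y hy
    obtain ⟨a, -, rfl⟩ := List.mem_map.mp hx
    obtain ⟨b, -, rfl⟩ := List.mem_map.mp hy
    exact Sum.Lex.sep a b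

/-! ### Words of elements of `𝓕ⁿ` -/

namespace FockPow

theorem mat_injective : Function.Injective (mat : FockPow pA pB n → A ⊕ B → Fin n → ℕ) := by
  intro T U h
  funext j
  have h1 : (T j).pos = (U j).pos :=
    Row.ext_count fun a => congrFun (congrFun h (.inl a)) j
  have h2 : (T j).neg = (U j).neg :=
    Row.ext_count fun b => congrFun (congrFun h (.inr b)) j
  cases hT : T j
  cases hU : U j
  rw [hT, hU] at h1 h2
  cases h1; cases h2; rfl

theorem label_of_mem_rowWord {T : FockPow pA pB n} {c : A ⊕ B} {x : Letter A B n}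
    (h : x ∈ T.rowWord c) : x.label = c := by
  rcases c with a | b <;> simp only [rowWord] at h <;> split_ifs at h <;>
    simp only [List.mem_reverse, List.mem_flatMap] at h <;>
    obtain ⟨j, -, hj⟩ := h <;> rw [List.eq_of_mem_replicate hj] <;> rfl

theorem count_rowWord (T : FockPow pA pB n) (c : A ⊕ B) (j : Fin n) :
    (T.rowWord c).count (Letter.mk c j) = T.mat c j := by
  have key : ∀ L : List (Fin n), L.Nodup → (∀ j, j ∈ L) → ∀ c : A ⊕ B,
      (L.flatMap fun j => List.replicate (T.mat c j) (Letter.mk c j)).count (Letter.mk c j) =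
        T.mat c j := fun L hL hmem c => by
    rw [List.count_flatMap_of_label Letter.pos _ _ hL _ fun h => absurd (hmem _) h]
    · simp
    · intro k x hx
      rw [List.eq_of_mem_replicate hx, Letter.pos_mk]
  rcases c with a | b <;> simp only [rowWord] <;> split_ifs <;>
    (try rw [List.count_reverse])
  · exact key _ (List.nodup_finRange n) List.mem_finRange (.inl a)
  · exact key _ (List.nodup_finRange n) List.mem_finRange (.inl a)
  · exact key _ (List.nodup_reverse.mpr (List.nodup_finRange n))
      (fun j => List.mem_reverse.mpr (List.mem_finRange j)) (.inr b)
  · exact key _ (List.nodup_reverse.mpr (List.nodup_finRange n))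
      (fun j => List.mem_reverse.mpr (List.mem_finRange j)) (.inr b)

theorem count_word (T : FockPow pA pB n) (c : A ⊕ B) (j : Fin n) :
    T.word.count (Letter.mk c j) = T.mat c j := by
  rw [word, List.count_flatMap_of_label Letter.label _ (fun c x => label_of_mem_rowWord)
    (rowOrder_nodup _ _), Letter.label_mk, count_rowWord]
  intro h
  rw [Letter.label_mk, mem_rowOrder] at h
  rw [Letter.label_mk, ← List.count_eq_zero, count_rowWord]
  rcases c with a | b <;> simp at h <;>
    exact List.count_eq_zero_of_not_mem (h j)

theorem pairwise_rowWord (T : FockPow pA pB n) (c : A ⊕ B) :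
    (T.rowWord c).Pairwise (Letter.Rel pA pB) := by
  have hlt := List.pairwise_lt_finRange n
  rcases c with a | b <;> simp only [rowWord] <;> split_ifs with hp
  · rw [List.pairwise_reverse, List.pairwise_flatMap]
    refine ⟨fun j _ => List.pairwise_replicate.mpr (Or.inr ?_), hlt.imp ?_⟩
    · simp [Letter.Rel, hp]
    · intro j k hjk x hx y hy
      rw [List.eq_of_mem_replicate hx, List.eq_of_mem_replicate hy]
      simp [Letter.Rel, hp, hjk.le]
  · rw [List.pairwise_flatMap]
    refine ⟨fun j _ => List.pairwise_replicate.mpr (Or.inl ((T j).pos.count_le a hp)), hlt.imp ?_⟩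
    intro j k hjk x hx y hy
    rw [List.eq_of_mem_replicate hx, List.eq_of_mem_replicate hy]
    simp [Letter.Rel, hp, hjk]
  · rw [List.pairwise_reverse, List.pairwise_flatMap, List.pairwise_reverse]
    refine ⟨fun j _ => List.pairwise_replicate.mpr (Or.inr ?_), hlt.imp ?_⟩
    · simp [Letter.Rel, hp]
    · intro j k hjk x hx y hy
      rw [List.eq_of_mem_replicate hx, List.eq_of_mem_replicate hy]
      simp [Letter.Rel, hp, hjk.le]
  · rw [List.pairwise_flatMap, List.pairwise_reverse]
    refine ⟨fun j _ => List.pairwise_replicate.mpr (Or.inl ((T j).neg.count_le b hp)), hlt.imp ?_⟩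
    intro j k hjk x hx y hy
    rw [List.eq_of_mem_replicate hx, List.eq_of_mem_replicate hy]
    simp [Letter.Rel, hp, hjk]

theorem pairwise_word (T : FockPow pA pB n) : T.word.Pairwise (Letter.Rel pA pB) := by
  rw [word, List.pairwise_flatMap]
  refine ⟨fun c _ => T.pairwise_rowWord c, (rowOrder_pairwise _ _).imp ?_⟩
  intro c d hcd x hx y hy
  rw [← label_of_mem_rowWord hx, ← label_of_mem_rowWord hy] at hcd
  exact Letter.rel_of_lex hcd

theorem word_injective :
    Function.Injective (word : FockPow pA pB n → List (Letter A B n)) := by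
  intro T U h
  refine mat_injective (funext fun c => funext fun j => ?_)
  rw [← count_word, ← count_word, h]

/-- The entries from `A` in the `j`-th component of a word. -/
def selectA {A B : Type*} {n : ℕ} (j : Fin n) : Letter A B n → Option A
  | .inl (a, k) => if k = j then some a else none
  | .inr _ => none

/-- The entries from `B` in the `j`-th component of a word. -/
def selectB {A B : Type*} {n : ℕ} (j : Fin n) : Letter A B n → Option B
  | .inl _ => none
  | .inr (b, k) => if k = j then some b else none

theorem count_selectA (w : List (Letter A B n)) (j : Fin n) (a : A) :
    (w.filterMap (selectA j)).count a = w.count (Letter.mk (.inl a) j) := by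
  refine List.count_filterMap_of_iff _ _ _ (fun z => ?_) w
  rcases z with ⟨a', k⟩ | ⟨b, k⟩ <;> simp [selectA, Letter.mk]
  tauto

theorem count_selectB (w : List (Letter A B n)) (j : Fin n) (b : B) :
    (w.filterMap (selectB j)).count b = w.count (Letter.mk (.inr b) j) := by
  refine List.count_filterMap_of_iff _ _ _ (fun z => ?_) w
  rcases z with ⟨a, k⟩ | ⟨b', k⟩ <;> simp [selectB, Letter.mk]
  tauto

/-- The words of elements of `𝓕ⁿ` are those whose letters are in order. -/
theorem exists_word_eq {w : List (Letter A B n)} (hw : w.Pairwise (Letter.Rel pA pB)) :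
    ∃ T : FockPow pA pB n, w = T.word := by
  have hA : ∀ j a, pA a ≠ 0 → Multiset.count a (w.filterMap (selectA j) : Multiset A) ≤ 1 :=
    fun j a ha => by
      rw [Multiset.coe_count, count_selectA]
      -- `Letter.Rel` is irreflexive at odd labels, so a sorted word does not repeat such a letter.
      exact hw.count_le_one (by simp [Letter.Rel, Letter.mk, ha])
  have hB : ∀ j b, pB b ≠ 0 → Multiset.count b (w.filterMap (selectB j) : Multiset B) ≤ 1 :=
    fun j b hb => by
      rw [Multiset.coe_count, count_selectB]
      exact hw.count_le_one (by simp [Letter.Rel, Letter.mk, hb])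
  let T : FockPow pA pB n := fun j => ⟨.ofMultiset _ (hA j), .ofMultiset _ (hB j)⟩
  refine ⟨T, List.Perm.eq_of_pairwise (fun x y _ _ => Letter.Rel.antisymm) hw T.pairwise_word
    (List.perm_iff_count.mpr fun x => ?_)⟩
  rw [Letter.eq_mk x, count_word]
  rcases x.label with a | b
  · exact ((Row.count_ofMultiset _ (hA _) a).trans
      ((Multiset.coe_count _ _).trans (count_selectA w x.pos a))).symm
  · exact ((Row.count_ofMultiset _ (hB _) b).trans
      ((Multiset.coe_count _ _).trans (count_selectB w x.pos b))).symm

theorem wordWt_eq {A B : Type*} {n : ℕ} (w : List (Letter A B n)) (j : Fin n) :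
    (letters A B n).wordWt w j =
      (w.filterMap (selectA j)).length - (w.filterMap (selectB j)).length := by
  induction w with
  | nil => rfl
  | cons x w ih =>
    rw [wordWt, Pi.add_apply, ih, List.filterMap_cons, List.filterMap_cons]
    rcases x with ⟨a, k⟩ | ⟨b, k⟩ <;> by_cases h : k = j <;>
      simp [CrystalData.union, CrystalData.copies, CrystalData.nat, CrystalData.dual, selectA,
        selectB, h] <;> ring

/-- This ties the exponent in `S_i` to the number of entries that `ς_i` moves: the weight of `T` is
the tuple of shapes. -/
theorem wordWt_word (T : FockPow pA pB n) (j : Fin n) :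
    (letters A B n).wordWt T.word j = (T j).shape := by
  have h1 : (T.word.filterMap (selectA j)).Perm (T j).pos.entries :=
    List.perm_iff_count.mpr fun a => (count_selectA _ _ _).trans (T.count_word (.inl a) j)
  have h2 : (T.word.filterMap (selectB j)).Perm (T j).neg.entries :=
    List.perm_iff_count.mpr fun b => (count_selectB _ _ _).trans (T.count_word (.inr b) j)
  rw [wordWt_eq, h1.length_eq, h2.length_eq, Fock.shape]

/-! ### The crystal structure -/

theorem isStrictEmbedding (pA : A → ZMod 2) (pB : B → ZMod 2) (n : ℕ) :
    (fockCrystal pA pB n).IsStrictEmbedding (labelledWords A B n) word :=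
  pullback_isStrictEmbedding _ word_injective
    -- An `e_i`-arrow is an `f_i`-arrow read backwards, hence the need for an equivalence in
    -- `Letter.pairwise_f_iff`.
    (fun _ T _ h => exists_word_eq ((Letter.pairwise_f_iff
      (Letter.isCrystal.wordF_of_wordE _ _ _ h)).mpr T.pairwise_word))
    (fun _ T _ h => exists_word_eq ((Letter.pairwise_f_iff h).mp T.pairwise_word))

theorem isCrystal (pA : A → ZMod 2) (pB : B → ZMod 2) (n : ℕ) :
    (fockCrystal pA pB n).IsCrystal :=
  (isStrictEmbedding pA pB n).isCrystal Letter.isCrystal.words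

theorem isSeminormal (pA : A → ZMod 2) (pB : B → ZMod 2) (n : ℕ) :
    (fockCrystal pA pB n).IsSeminormal :=
  (isStrictEmbedding pA pB n).toMorphism.isSeminormal (Letter.isSeminormal.words Letter.isCrystal)

theorem label_wordF {A B : Type*} {n : ℕ} {i : Fin (n - 1)} {w w' : List (Letter A B n)}
    (h : (letters A B n).wordF i w = some w') : w'.map Letter.label = w.map Letter.label := by
  obtain ⟨u, x, x', v, p, q, rfl, rfl, hx, -⟩ := wordF_eq_some (lab := Letter.label)
    Letter.isCrystal Letter.isSeminormal Letter.isMinuscule (Letter.label_f i) h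
  simp [Letter.label_f i _ _ hx]

theorem label_word_of_connected {T U : FockPow pA pB n}
    (h : (fockCrystal pA pB n).Connected T U) :
    T.word.map Letter.label = U.word.map Letter.label := by
  induction h with
  | rel T U hTU =>
    obtain ⟨i, hi | hi⟩ := hTU
    · refine (label_wordF (i := i) ?_).symm
      exact ((isStrictEmbedding pA pB n).f_eq i T).trans (by rw [hi]; rfl)
    · rw [← (isCrystal pA pB n).f_eq_iff] at hi
      refine label_wordF (i := i) ?_
      exact ((isStrictEmbedding pA pB n).f_eq i U).trans (by rw [hi]; rfl)
  | refl T => rfl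
  | symm T U _ ih => exact ih.symm
  | trans T U V _ _ ih1 ih2 => exact ih1.trans ih2

theorem eq_of_map_label_forget {A B : Type*} {n : ℕ} {w w' : List (Letter A B n)}
    (h1 : w.map Letter.label = w'.map Letter.label)
    (h2 : w.map Letter.forget = w'.map Letter.forget) : w = w' := by
  induction w generalizing w' with
  | nil => simpa using h1.symm
  | cons x w ih =>
    cases w' with
    | nil => simp at h1
    | cons y w' =>
      simp only [List.map_cons, List.cons.injEq] at h1 h2
      rw [ih h1.2 h2.2]
      congr 1
      have h3 := h1.1
      have h4 := h2.1
      rcases x with ⟨a, j⟩ | ⟨b, j⟩ <;> rcases y with ⟨a', j'⟩ | ⟨b', j'⟩ <;>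
        simp_all [Letter.label, Letter.forget]

theorem isRegular (pA : A → ZMod 2) (pB : B → ZMod 2) (n : ℕ) :
    (fockCrystal pA pB n).IsRegular := by
  have hm := Letter.forget_isStrictMorphism.words.comp (isStrictEmbedding pA pB n).toMorphism
  refine isRegular_of (isCrystal pA pB n) (isSeminormal pA pB n) fun T => ⟨_, hm.equivalent
    ((nat_isCrystal n).union (nat_isCrystal n).dual).words (fun U V h hUV => ?_) T⟩
  exact word_injective (eq_of_map_label_forget (label_word_of_connected h) hUV)

end FockPow

/-! ### Signs -/

/-- The order in which signs appear in the sequence of signs. -/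
def SignRel (pA : A → ZMod 2) (pB : B → ZMod 2) (x y : Bool × (A ⊕ B)) : Prop :=
  Sum.Lex (· > ·) (· < ·) x.2 y.2 ∨
    (x.2 = y.2 ∧ if Sum.elim pA pB x.2 = 0 then x.1 ≤ y.1 else y.1 ≤ x.1)

theorem SignRel.antisymm {x y : Bool × (A ⊕ B)} (h1 : SignRel pA pB x y)
    (h2 : SignRel pA pB y x) : x = y := by
  obtain ⟨s, c⟩ := x
  obtain ⟨t, d⟩ := y
  have hc : c = d := by
    rcases c with c | c <;> rcases d with d | d <;> simp [SignRel] at h1 h2 ⊢ <;> grind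
  subst hc
  have : ¬Sum.Lex (· > ·) (· < ·) c c := by rcases c with c | c <;> simp
  simp only [SignRel, this, false_or, true_and] at h1 h2
  split_ifs at h1 h2
  · rw [le_antisymm h1 h2]
  · rw [le_antisymm h2 h1]

theorem pairwise_signBlock (T₁ T₂ : Fock pA pB) (c : A ⊕ B) :
    (signBlock T₁ T₂ c).Pairwise (SignRel pA pB) := by
  rcases c with a | b <;> simp only [signBlock] <;> split_ifs with hp <;>
    refine List.pairwise_append.mpr ⟨List.pairwise_replicate.mpr (Or.inr ?_),
      List.pairwise_replicate.mpr (Or.inr ?_), fun x hx y hy => ?_⟩ <;>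
    first
    | simp [SignRel]
      done
    | rw [List.eq_of_mem_replicate hx, List.eq_of_mem_replicate hy]; simp [SignRel, hp]

theorem pairwise_signs (T₁ T₂ : Fock pA pB) : (signs T₁ T₂).Pairwise (SignRel pA pB) := by
  rw [signs, List.pairwise_flatMap]
  refine ⟨fun c _ => pairwise_signBlock T₁ T₂ c, (rowOrder_pairwise _ _).imp ?_⟩
  intro c d hcd x hx y hy
  rw [← mem_signBlock hx, ← mem_signBlock hy] at hcd
  exact Or.inl hcd

/-- A row is read from right to left and a column from top to bottom. Restricted to the indices `i`
and `i + 1`, this puts `-` before `+` for even labels and `+` before `-` for odd ones, in `A` and in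
`B` alike, exactly as in the blocks `s_c`. -/
theorem signRel_of_rel (i : Fin (n - 1)) {s t : Bool} {c d : A ⊕ B}
    (h : Letter.Rel pA pB (Letter.mk c (Letter.signPos i s c))
      (Letter.mk d (Letter.signPos i t d))) : SignRel pA pB (s, c) (t, d) := by
  rcases c with a | b <;> rcases d with a' | b' <;> cases s <;> cases t <;>
    simp [Letter.Rel, SignRel, Letter.mk, Letter.signPos] at h ⊢ <;>
    rcases h with h | ⟨rfl, h⟩ <;> (try exact Or.inl h) <;> right <;>
    (try split_ifs at h ⊢) <;>
    simp_all [Fin.le_def, Fin.lt_def, lo, hi]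

/-! ### Local energy and `R`-matrix in terms of the crystal -/

namespace FockPow

theorem count_signs (T : FockPow pA pB n) (i : Fin (n - 1)) (s : Bool) (c : A ⊕ B) :
    (signs (T (lo i)) (T (hi i))).count (s, c) = T.mat c (Letter.signPos i s c) := by
  have h : (signBlock (T (lo i)) (T (hi i)) c).count (s, c) =
      T.mat c (Letter.signPos i s c) := by
    rcases c with a | b <;> simp only [signBlock] <;> split_ifs <;> cases s <;>
      simp [List.count_replicate, Letter.signPos, mat]
  rw [signs, List.count_flatMap_of_label Prod.snd _ (fun c x => mem_signBlock)
    (rowOrder_nodup _ _), h]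
  intro hc
  rw [mem_rowOrder] at hc
  rw [← List.count_eq_zero, h]
  rcases c with a | b <;> simp at hc <;> cases s <;>
    first
    | exact List.count_eq_zero_of_not_mem hc.1
    | exact List.count_eq_zero_of_not_mem hc.2

/-- The sequences agree even before reduction: both are sorted for the antisymmetric `SignRel` and
have the same multiplicities. -/
theorem reducedSigns_eq (T : FockPow pA pB n) (i : Fin (n - 1)) :
    reducedSigns (T (lo i)) (T (hi i)) = (letters A B n).wordSigns Letter.label i T.word := by
  refine congrArg reduce (List.Perm.eq_of_pairwise (fun x y _ _ => SignRel.antisymm)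
    (pairwise_signs _ _) ?_ (List.perm_iff_count.mpr fun x => ?_))
  · refine T.pairwise_word.filterMap _ ?_
    rintro x y h ⟨s, c⟩ hx ⟨t, d⟩ hy
    rw [Letter.letterSign_eq_some_iff] at hx hy
    subst hx hy
    exact signRel_of_rel i h
  · obtain ⟨s, c⟩ := x
    rw [count_signs, List.count_filterMap_of_iff _ _ _
      fun z => Letter.letterSign_eq_some_iff i z s c, count_word]

/-- The entries of the signs `+` of `T` for the index `i`. -/
def plus (T : FockPow pA pB n) (i : Fin (n - 1)) : List (A ⊕ B) := plusEntries (T (lo i)) (T (hi i))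

/-- The entries of the signs `-` of `T` for the index `i`. -/
def minus (T : FockPow pA pB n) (i : Fin (n - 1)) : List (A ⊕ B) :=
  minusEntries (T (lo i)) (T (hi i))

theorem plus_minus_eq {T : FockPow pA pB n} {i : Fin (n - 1)} {p q : List (A ⊕ B)}
    (h : (letters A B n).wordSigns Letter.label i T.word =
      p.map (Prod.mk false) ++ q.map (Prod.mk true)) : T.plus i = q ∧ T.minus i = p := by
  simp [plus, minus, plusEntries, minusEntries, reducedSigns_eq, h, List.filter_map,
    Function.comp_def]

theorem length_plus_minus (T : FockPow pA pB n) (i : Fin (n - 1)) :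
    ((T.plus i).length : ℤ) = (fockCrystal pA pB n).φ i T ∧
      ((T.minus i).length : ℤ) = (fockCrystal pA pB n).ε i T := by
  obtain ⟨p, q, h, hp, hq⟩ := wordSigns_eq (lab := Letter.label) Letter.isCrystal
    Letter.isSeminormal Letter.isMinuscule i T.word
  obtain ⟨h1, h2⟩ := plus_minus_eq h
  rw [h1, h2]
  exact ⟨hq, hp⟩

theorem energyAt_eq (T : FockPow pA pB n) (i : Fin (n - 1)) :
    T.energyAt i = -min ((fockCrystal pA pB n).ε i T) ((fockCrystal pA pB n).φ i T) := by
  rw [← (T.length_plus_minus i).1, ← (T.length_plus_minus i).2]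
  rfl

/-- The change of the row `c` of the matrix when the sign `+` of an entry `c` becomes `-`. -/
def direction {A B : Type*} {n : ℕ} (i : Fin (n - 1)) (c : A ⊕ B) : Fin n → ℤ :=
  Sum.elim (fun _ => -simpleRoot i) (fun _ => simpleRoot i) c

theorem direction_eq {A B : Type*} {n : ℕ} (i : Fin (n - 1)) (c : A ⊕ B) (j : Fin n) :
    direction i c j = (if j = Letter.signPos i false c then 1 else 0) -
      (if j = Letter.signPos i true c then 1 else 0) := by
  rcases c with a | b <;> simp [direction, Letter.signPos, simpleRoot, Pi.single_apply]

/-- The first sign `+` becomes the last sign `-`, while the other reduced signs keep their entries.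
Iterating `f_i` therefore consumes the signs `+` of the original sequence from the left, and
iterating `e_i` consumes the signs `-` from the right. -/
theorem f_eq_some {T U : FockPow pA pB n} {i : Fin (n - 1)}
    (h : (fockCrystal pA pB n).f i T = some U) :
    ∃ c, T.plus i = c :: U.plus i ∧ U.minus i = T.minus i ++ [c] ∧
      ∀ d j, (U.mat d j : ℤ) = T.mat d j + ([c].count d : ℤ) * direction i d j := by
  have hw : (letters A B n).wordF i T.word = some U.word :=
    ((isStrictEmbedding pA pB n).f_eq i T).trans (by rw [h]; rfl)
  obtain ⟨u, x, x', v, p, q, hT, hU, hx, -, -, -, h1, h2⟩ := wordF_eq_some (lab := Letter.label)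
    Letter.isCrystal Letter.isSeminormal Letter.isMinuscule (Letter.label_f i) hw
  obtain ⟨c, rfl, rfl⟩ := (Letter.f_eq_some_iff i x x').mp hx
  rw [Letter.label_mk] at h1 h2
  obtain ⟨h3, h4⟩ := plus_minus_eq h1
  obtain ⟨h5, h6⟩ := plus_minus_eq h2
  refine ⟨c, by rw [h3, h5], by rw [h4, h6], fun d j => ?_⟩
  rw [← count_word, ← count_word, hT, hU, direction_eq]
  simp only [List.count_append, List.count_cons, List.count_nil, beq_iff_eq, Letter.mk_inj]
  by_cases hcd : c = d
  · subst hcd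
    simp only [true_and, eq_comm (a := j)]
    push_cast
    ring
  · simp [hcd]

theorem iter_f_eq_some {i : Fin (n - 1)} {k : ℕ} {T U : FockPow pA pB n}
    (h : iter ((fockCrystal pA pB n).f i) k T = some U) (d : A ⊕ B) (j : Fin n) :
    (U.mat d j : ℤ) = T.mat d j + (((T.plus i).take k).count d : ℤ) * direction i d j := by
  induction k generalizing T with
  | zero => cases h; simp
  | succ k ih =>
    obtain ⟨V, hV, hU⟩ := Option.bind_eq_some_iff.mp h
    obtain ⟨c, h1, -, h2⟩ := f_eq_some hV
    rw [ih hU, h2, h1, List.take_succ_cons, List.count_cons, List.count_cons, List.count_nil]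
    push_cast
    ring

theorem iter_e_eq_some {i : Fin (n - 1)} {k : ℕ} {T U : FockPow pA pB n}
    (h : iter ((fockCrystal pA pB n).e i) k T = some U) (d : A ⊕ B) (j : Fin n) :
    (U.mat d j : ℤ) =
      T.mat d j - (((T.minus i).reverse.take k).count d : ℤ) * direction i d j := by
  induction k generalizing T with
  | zero => cases h; simp
  | succ k ih =>
    obtain ⟨V, hV, hU⟩ := Option.bind_eq_some_iff.mp h
    obtain ⟨c, -, h1, h2⟩ := f_eq_some (((isCrystal pA pB n).f_eq_iff i V T).mpr hV)
    rw [ih hU, h2, h1, List.reverse_append, List.reverse_singleton, List.singleton_append,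
      List.take_succ_cons, List.count_cons, List.count_cons, List.count_nil]
    push_cast
    ring

theorem coroot_wt (T : FockPow pA pB n) (i : Fin (n - 1)) :
    coroot i ((fockCrystal pA pB n).wt T) = (T (lo i)).shape - (T (hi i)).shape := by
  rw [← wordWt_word, ← wordWt_word]
  rfl

theorem mat_rAt (T : FockPow pA pB n) (i : Fin (n - 1)) (d : A ⊕ B) (j : Fin n) :
    (T.rAt i).mat d j = if j = hi i then (rMatrix (T (lo i)) (T (hi i))).2.mult d
      else if j = lo i then (rMatrix (T (lo i)) (T (hi i))).1.mult d else T.mat d j := by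
  simp only [rAt, mat, Function.update_apply]
  split_ifs <;> rfl

theorem rAt_eq_of_gt {T U : FockPow pA pB n} {i : Fin (n - 1)}
    (hs : (T (hi i)).shape < (T (lo i)).shape)
    (h : ∀ d j, (U.mat d j : ℤ) =
      T.mat d j + ((movesPlus (T (lo i)) (T (hi i))).count d : ℤ) * direction i d j) :
    T.rAt i = U := by
  refine mat_injective (funext fun d => funext fun j => ?_)
  have h1 := h d j
  have hne := lo_ne_hi i
  rw [mat_rAt, rMatrix, if_neg hs.ne', if_pos hs]
  rw [direction_eq] at h1
  rcases d with a | b <;> simp only [Letter.signPos, Sum.elim_inl, Sum.elim_inr] at h1 <;>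
    split_ifs with e1 e2
  all_goals
    first
    | subst e1
    | subst e2
    | skip
  -- `Row.count_remove` subtracts in `ℕ`. By `h1` the integer difference is an entry of the matrix
  -- of `U`, hence nonnegative, so nothing is truncated.
  all_goals
    simp [mat, Fock.mult, Row.count_remove, Row.count_insert, count_inA, count_inB, *, hne.symm]
      at h1 ⊢
    try omega

theorem rAt_eq_of_lt {T U : FockPow pA pB n} {i : Fin (n - 1)}
    (hs : (T (lo i)).shape < (T (hi i)).shape)
    (h : ∀ d j, (U.mat d j : ℤ) =
      T.mat d j - ((movesMinus (T (lo i)) (T (hi i))).count d : ℤ) * direction i d j) :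
    T.rAt i = U := by
  refine mat_injective (funext fun d => funext fun j => ?_)
  have h1 := h d j
  have hne := lo_ne_hi i
  rw [mat_rAt, rMatrix, if_neg hs.ne, if_neg hs.not_gt]
  rw [direction_eq] at h1
  rcases d with a | b <;> simp only [Letter.signPos, Sum.elim_inl, Sum.elim_inr] at h1 <;>
    split_ifs with e1 e2
  all_goals
    first
    | subst e1
    | subst e2
    | skip
  all_goals
    simp [mat, Fock.mult, Row.count_remove, Row.count_insert, count_inA, count_inB, *, hne.symm]
      at h1 ⊢
    try omega

theorem rAt_eq_weyl (T : FockPow pA pB n) (i : Fin (n - 1)) :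
    T.rAt i = (fockCrystal pA pB n).weyl i T := by
  have hφ := (isCrystal pA pB n).φ_sub_ε i T
  have hε0 := (isSeminormal pA pB n).ε_nonneg i T
  have hφ0 := (isSeminormal pA pB n).φ_nonneg i T
  have hwt := T.coroot_wt i
  rw [weyl]
  split_ifs with h
  · rcases h.eq_or_lt with h0 | h0
    · rw [← h0]
      have h1 : (T (lo i)).shape = (T (hi i)).shape := by omega
      simp [iter, rAt, rMatrix, h1]
    -- The exponent is `φ_i - ε_i ≤ φ_i`, so the iterate is not `0` and the default value in `weyl`
    -- plays no role; the case of `e_i` below is symmetric.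
    · obtain ⟨U, hU⟩ := Option.ne_none_iff_exists'.mp (((isSeminormal pA pB n).f_string
        (isCrystal pA pB n) i (coroot i ((fockCrystal pA pB n).wt T)).toNat T).mpr (by omega))
      rw [hU, Option.getD_some]
      refine rAt_eq_of_gt (by omega) fun d j => ?_
      rw [iter_f_eq_some hU, hwt]
      rfl
  · obtain ⟨U, hU⟩ := Option.ne_none_iff_exists'.mp (((isSeminormal pA pB n).e_string
      (isCrystal pA pB n) i (-coroot i ((fockCrystal pA pB n).wt T)).toNat T).mpr (by omega))
    rw [hU, Option.getD_some]
    refine rAt_eq_of_lt (by omega) fun d j => ?_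
    rw [iter_e_eq_some hU, hwt, neg_sub]
    rfl

/-- Both sides apply operators along the same sequence of indices, so `ς_i = S_i` as functions
together with the formula for `H_s` makes the sums agree term by term. -/
theorem energy_eq (T : FockPow pA pB n) :
    T.energy = -∑ α : PosRoot n,
      min ((fockCrystal pA pB n).εRoot α T) ((fockCrystal pA pB n).φRoot α T) := by
  have h : (rAt : Fin (n - 1) → FockPow pA pB n → _) = (fockCrystal pA pB n).weyl :=
    funext fun i => funext fun T => T.rAt_eq_weyl i
  simp only [energy, energyAt_eq, h, Finset.sum_neg_distrib]
  rfl

end FockPow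

end FockCrystal

open FockCrystal in
theorem mainTheorem6 {A B : Type*} [LinearOrder A] [Countable A] [LinearOrder B] [Countable B]
    (pA : A → ZMod 2) (pB : B → ZMod 2) (n : ℕ) :
    (fockCrystal pA pB n).IsStrictEmbedding (labelledWords A B n) FockPow.word ∧
    (fockCrystal pA pB n).IsRegular ∧
    (∀ (i : Fin (n - 1)) (T : FockPow pA pB n),
      T.energyAt i = -min ((fockCrystal pA pB n).ε i T) ((fockCrystal pA pB n).φ i T) ∧
      T.rAt i = (fockCrystal pA pB n).weyl i T) ∧
    (∀ T : FockPow pA pB n,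
      T.energy = -∑ α : PosRoot n,
        min ((fockCrystal pA pB n).εRoot α T) ((fockCrystal pA pB n).φRoot α T)) :=
  ⟨FockPow.isStrictEmbedding pA pB n, FockPow.isRegular pA pB n,
    fun i T => ⟨T.energyAt_eq i, T.rAt_eq_weyl i⟩, fun T => T.energy_eq⟩
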